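/- We work in many-sorted continuous logic with bounded metric sorts, where formulas take values in bounded intervals of $\mathbb R$ and every uniformly continuous function $\mathbb R^n\to\mathbb R$ is a connective. For a structure $M$, a definable predicate with parameters in $M$ is a uniform limit on $M^n$ of formulas $\varphi(\bar x,\bar a)$ with $\bar a$ in $M$. For a theory $T$, a ($T$-)definable predicate is a limit of formulas without parameters, uniformly over all models of $T$. A definable group $G$ is given by $T$-definable predicates $D(\bar x)$ and $Q(\bar x,\bar y,\bar z)$. It is a definable group in $M$ if, for $G(M)=\{\bar x\in M^n: D^M(\bar x)=0\}$, $D^M(\bar x)$ is the distance from $\bar x$ to $G(M)$, and $G(M)$ is a group with $Q^M(g,h,k)=d(g\cdot h,k)$ for $g,h,k\in G(M)$. A mean on $G(M)$ is a linear functional $\mathfrak m$ on the space of restrictions to $G(M)$ of definable predicates with parameters in $M$, such that $\mathfrak m(P)\ge 0$ if $P\ge 0$ and $\mathfrak m(\mathbf 1)=1$. It is invariant if $\mathfrak m(g\cdot P)=\mathfrak m(P)$ for all $g\in G(M)$ and all $P$, where $(g\cdot P)(x)=P(g^{-1}x)$ on $G(M)$. It is a type if its kernel (the set of definable predicates $P$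 with parameters in $M$ such that $\mathfrak m(P|_{G(M)})=0$) is a complete type over $M$, i.e. a maximal consistent set of predicates; here a set of predicates is consistent if its members vanish at a common tuple of some elementary extension of $M$. $G(M)$ is definably amenable if it has an invariant mean, and extremely definably amenable if it has an invariant mean which is a type. Theorem. Let $(M_i)_{i\in I}$ be a family of elementarily equivalent metric structures with common theory $T$, let $\mathcal U$ be an ultrafilter on $I$, and let $G$ be given by $T$-definable predicates and be a definable group in every $M_i$. Then $G$ (through the same predicates) is a definable group in the metric ultraproduct $\prod_{\mathcal U}M_i$. If $G(M_i)$ is definably amenable for every $i$, then so is $G(\prod_{\mathcal U}M_i)$; if $G(M_i)$ is extremely definably amenable for every $i$, then so is $G(\prod_{\mathcal U}M_i)$. More precisely, if $\mathfrak m_i$ is an invariant mean on $G(M_i)$ for every $i$, then there is a unique mean $\hat{\mathfrak m}$ on $G(\prod_{\mathcal U}M_i)$ with $$\hat{\mathfrak m}(\varphi(\bar x,[\bar a_i]))=\lim_{\mathcal U}\mathfrak m_i(\varphi(\bar x,\bar a_i))$$ for all formulas $\varphi(\bar x,\bar y)$ and all tuples $\bar a_i$ in $M_i$; it is invariant, and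 it is a type if every $\mathfrak m_i$ is a type. -/

import Mathlib

open Filter Topology

universe u v w

/-- A language of (many-sorted, bounded) continuous logic. The metric symbols `d_S` are logical
symbols: they are built into terms and formulas below. Function symbols of arity `0` are
constants. -/
structure MetricLanguage where
  Sorts : Type u
  /-- the bound `M_S` on the metric of the sort `S` -/
  bound : Sorts → ℝ
  bound_pos : ∀ s, 0 < bound s
  Fun : Type u
  funArity : Fun → ℕ
  funDom : (f : Fun) → Fin (funArity f) → Sorts
  funRng : Fun → Sorts
  /-- uniform continuity modulus of `f` in its `k`-th argument -/
  funMod : (f : Fun) → Fin (funArity f) → ℝ → ℝ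
  funMod_pos : ∀ f k ε, 0 < ε → 0 < funMod f k ε
  Rel : Type u
  relArity : Rel → ℕ
  relDom : (R : Rel) → Fin (relArity R) → Sorts
  /-- the range of `R` is the bounded interval `[relLo R, relHi R]` -/
  relLo : Rel → ℝ
  relHi : Rel → ℝ
  relLo_le_relHi : ∀ R, relLo R ≤ relHi R
  relMod : (R : Rel) → Fin (relArity R) → ℝ → ℝ
  relMod_pos : ∀ R k ε, 0 < ε → 0 < relMod R k ε

namespace MetricLanguage

/-- Metric structures: one non-empty bounded metric space for each sort, and uniformly continuous
interpretations of the symbols obeying the prescribed moduli. Completeness of the metric spaces is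
not required. -/
structure Structure (L : MetricLanguage.{u}) where
  carrier : L.Sorts → Type v
  metric : ∀ s, MetricSpace (carrier s)
  nonempty : ∀ s, Nonempty (carrier s)
  dist_le_bound : ∀ s (x y : carrier s), dist x y ≤ L.bound s
  funMap : (f : L.Fun) → (∀ k, carrier (L.funDom f k)) → carrier (L.funRng f)
  funMap_unif : ∀ (f : L.Fun) (k : Fin (L.funArity f)) (ε : ℝ), 0 < ε →
    ∀ x y : (∀ l, carrier (L.funDom f l)), (∀ l, l ≠ k → x l = y l) →
      dist (x k) (y k) < L.funMod f k ε → dist (funMap f x) (funMap f y) ≤ ε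
  relMap : (R : L.Rel) → (∀ k, carrier (L.relDom R k)) → ℝ
  relMap_mem : ∀ R x, relMap R x ∈ Set.Icc (L.relLo R) (L.relHi R)
  relMap_unif : ∀ (R : L.Rel) (k : Fin (L.relArity R)) (ε : ℝ), 0 < ε →
    ∀ x y : (∀ l, carrier (L.relDom R l)), (∀ l, l ≠ k → x l = y l) →
      dist (x k) (y k) < L.relMod R k ε → |relMap R x - relMap R y| ≤ ε

instance {L : MetricLanguage.{u}} (M : Structure.{u, v} L) (s : L.Sorts) :
    MetricSpace (M.carrier s) := M.metric s

instance {L : MetricLanguage.{u}} (M : Structure.{u, v} L) (s : L.Sorts) :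
    Nonempty (M.carrier s) := M.nonempty s

/-- Assignments of elements of `M` to the variables of a context `Γ`. A context is a family of
variables (indexed by `α`), each with its sort. For `α = Fin n` these are the `n`-tuples, and they
carry the maximum metric. -/
abbrev Structure.Assign {L : MetricLanguage.{u}} (M : Structure.{u, v} L) {α : Type}
    (Γ : α → L.Sorts) : Type v := ∀ a, M.carrier (Γ a)

/-! ### Terms and formulas -/

/-- Terms, by their sort, with variables in the context `Γ`. -/
inductive Term (L : MetricLanguage.{u}) {α : Type} (Γ : α → L.Sorts) : L.Sorts → Type u
  | var (a : α) : Term L Γ (Γ a)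
  | app (f : L.Fun) (t : ∀ k, Term L Γ (L.funDom f k)) : Term L Γ (L.funRng f)

/-- The context `Γ` with one more variable (called `none`) of sort `s`. -/
def extCtx {L : MetricLanguage.{u}} {α : Type} (Γ : α → L.Sorts) (s : L.Sorts) :
    Option α → L.Sorts
  | none => s
  | some a => Γ a

/-- Formulas whose free variables are in the context `Γ`. Connectives are the uniformly continuous
functions `ℝⁿ → ℝ`; the quantifiers bind the additional variable of `extCtx Γ s`. -/
inductive Formula (L : MetricLanguage.{u}) : {α : Type} → (α → L.Sorts) → Type (max u 1)
  | distEq {α : Type} {Γ : α → L.Sorts} {s : L.Sorts} (t t' : Term L Γ s) : Formula L Γ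
  | rel {α : Type} {Γ : α → L.Sorts} (R : L.Rel) (t : ∀ k, Term L Γ (L.relDom R k)) : Formula L Γ
  | conn {α : Type} {Γ : α → L.Sorts} {n : ℕ} (c : (Fin n → ℝ) → ℝ) (hc : UniformContinuous c)
      (φ : Fin n → Formula L Γ) : Formula L Γ
  | inf {α : Type} {Γ : α → L.Sorts} (s : L.Sorts) (φ : Formula L (extCtx Γ s)) : Formula L Γ
  | sup {α : Type} {Γ : α → L.Sorts} (s : L.Sorts) (φ : Formula L (extCtx Γ s)) : Formula L Γ

variable {L : MetricLanguage.{u}}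

/-- Extend an assignment by the value `x` for the new variable. -/
def Structure.cons (M : Structure.{u, v} L) {α : Type} {Γ : α → L.Sorts} {s : L.Sorts}
    (x : M.carrier s) (v : M.Assign Γ) : M.Assign (extCtx Γ s)
  | none => x
  | some a => v a

/-- Juxtapose two assignments. -/
def Structure.pair (M : Structure.{u, v} L) {α β : Type} {Γ : α → L.Sorts} {Δ : β → L.Sorts}
    (x : M.Assign Γ) (y : M.Assign Δ) : M.Assign (Sum.elim Γ Δ)
  | .inl a => x a
  | .inr b => y b

def Term.eval (M : Structure.{u, v} L) {α : Type} {Γ : α → L.Sorts} (v : M.Assign Γ) :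
    {s : L.Sorts} → Term L Γ s → M.carrier s
  | _, .var a => v a
  | _, .app f t => M.funMap f (fun k => (t k).eval M v)

/-- The interpretation of a formula. (Interpretations are bounded, so `⨅` and `⨆` are genuine
infima and suprema.) -/
noncomputable def Formula.eval (M : Structure.{u, v} L) :
    {α : Type} → {Γ : α → L.Sorts} → Formula L Γ → M.Assign Γ → ℝ
  | _, _, .distEq t t', v => dist (t.eval M v) (t'.eval M v)
  | _, _, .rel R t, v => M.relMap R (fun k => (t k).eval M v)
  | _, _, .conn c _ φ, v => c (fun k => (φ k).eval M v)
  | _, _, .inf s φ, v => ⨅ x : M.carrier s, φ.eval M (M.cons x v)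
  | _, _, .sup s φ, v => ⨆ x : M.carrier s, φ.eval M (M.cons x v)

/-- Substitution of terms for variables. -/
def Term.subst {α β : Type} {Γ : α → L.Sorts} {Δ : β → L.Sorts} (σ : ∀ a, Term L Δ (Γ a)) :
    {s : L.Sorts} → Term L Γ s → Term L Δ s
  | _, .var a => σ a
  | _, .app f t => .app f (fun k => (t k).subst σ)

theorem Term.eval_subst (M : Structure.{u, v} L) {α β : Type} {Γ : α → L.Sorts}
    {Δ : β → L.Sorts} (σ : ∀ a, Term L Δ (Γ a)) (v : M.Assign Δ) {s : L.Sorts}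
    (t : Term L Γ s) : (t.subst σ).eval M v = t.eval M (fun a => (σ a).eval M v) := by
  induction t with
  | var a => rfl
  | app f t ih => simp only [Term.subst, Term.eval, ih]

/-- The substitution `σ` below a quantifier. -/
def liftSubst {α β : Type} {Γ : α → L.Sorts} {Δ : β → L.Sorts} (σ : ∀ a, Term L Δ (Γ a))
    (s : L.Sorts) : ∀ o, Term L (extCtx Δ s) (extCtx Γ s o)
  | none => Term.var (Γ := extCtx Δ s) none
  | some a => (σ a).subst (fun b => Term.var (Γ := extCtx Δ s) (some b))

def Formula.subst : {α β : Type} → {Γ : α → L.Sorts} → {Δ : β → L.Sorts} →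
    (∀ a, Term L Δ (Γ a)) → Formula L Γ → Formula L Δ
  | _, _, _, _, σ, .distEq t t' => .distEq (t.subst σ) (t'.subst σ)
  | _, _, _, _, σ, .rel R t => .rel R (fun k => (t k).subst σ)
  | _, _, _, _, σ, .conn c hc φ => .conn c hc (fun k => (φ k).subst σ)
  | _, _, _, _, σ, .inf s φ => .inf s (φ.subst (liftSubst σ s))
  | _, _, _, _, σ, .sup s φ => .sup s (φ.subst (liftSubst σ s))

theorem eval_liftSubst (M : Structure.{u, v} L) {α β : Type} {Γ : α → L.Sorts}
    {Δ : β → L.Sorts} (σ : ∀ a, Term L Δ (Γ a)) (v : M.Assign Δ) {s : L.Sorts}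
    (x : M.carrier s) :
    (fun o => (liftSubst σ s o).eval M (M.cons x v)) =
      M.cons x (fun a => (σ a).eval M v) := by
  funext o
  cases o with
  | none => rfl
  | some a => exact Term.eval_subst M _ _ (σ a)

theorem Formula.eval_subst (M : Structure.{u, v} L) {α : Type} {Γ : α → L.Sorts}
    (φ : Formula L Γ) {β : Type} {Δ : β → L.Sorts} (σ : ∀ a, Term L Δ (Γ a))
    (v : M.Assign Δ) : (φ.subst σ).eval M v = φ.eval M (fun a => (σ a).eval M v) := by
  induction φ generalizing β with
  | distEq t t' => simp only [Formula.subst, Formula.eval, Term.eval_subst]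
  | rel R t => simp only [Formula.subst, Formula.eval, Term.eval_subst]
  | conn c hc φ ih => simp only [Formula.subst, Formula.eval, ih]
  | inf s φ ih => simp only [Formula.subst, Formula.eval, ih, eval_liftSubst]
  | sup s φ ih => simp only [Formula.subst, Formula.eval, ih, eval_liftSubst]

/-! ### Theories, elementary extensions, parameter-free definable predicates -/

/-- Sentences: formulas in the empty context. -/
abbrev Sentence (L : MetricLanguage.{u}) : Type (max u 1) :=
  Formula L (fun a : Empty => (a.elim : L.Sorts))

abbrev Theory (L : MetricLanguage.{u}) : Type (max u 1) := Set (Sentence L)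

/-- The theory of `M`: the sentences with value `0` in `M`. Two structures are elementarily
equivalent when their theories coincide. -/
def Structure.theory (M : Structure.{u, v} L) : Theory L :=
  {φ | φ.eval M (fun a => a.elim) = 0}

def Structure.Models (M : Structure.{u, v} L) (T : Theory L) : Prop := T ⊆ M.theory

/-- `j` is an elementary embedding of `M` in `N`. -/
def IsElementary (M : Structure.{u, v} L) (N : Structure.{u, w} L)
    (j : ∀ s, M.carrier s → N.carrier s) : Prop :=
  ∀ (α : Type) (Γ : α → L.Sorts) (φ : Formula L Γ) (x : M.Assign Γ),
    φ.eval N (fun a => j _ (x a)) = φ.eval M x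

/-- A definable predicate of `T` (without parameters): an element of the completion of the space
of formulas with respect to the supremum over all models of `T`, presented by a Cauchy
sequence. -/
structure DefinablePredicate (T : Theory L) {α : Type} (Γ : α → L.Sorts) where
  seq : ℕ → Formula L Γ
  cauchy : ∀ ε : ℝ, 0 < ε → ∃ K : ℕ, ∀ k l, K ≤ k → K ≤ l →
    ∀ M : Structure.{u, v} L, M.Models T → ∀ x : M.Assign Γ,
      |(seq k).eval M x - (seq l).eval M x| ≤ ε

/-- The value of a definable predicate in a structure: the (uniform) limit of the formulas. -/
noncomputable def DefinablePredicate.eval {T : Theory L} {α : Type} {Γ : α → L.Sorts}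
    (P : DefinablePredicate.{u, v} T Γ) (M : Structure.{u, w} L) (x : M.Assign Γ) : ℝ :=
  limUnder atTop (fun k => (P.seq k).eval M x)

/-! ### Definable predicates with parameters in a structure, and types -/

/-- A formula `φ(x, a)` with a tuple `a` of parameters in `M`. -/
structure ParamFormula (M : Structure.{u, v} L) {α : Type} (Γ : α → L.Sorts) where
  {β : Type}
  {Δ : β → L.Sorts}
  form : Formula L (Sum.elim Γ Δ)
  par : M.Assign Δ

noncomputable def ParamFormula.eval {M : Structure.{u, v} L} {α : Type} {Γ : α → L.Sorts}
    (φ : ParamFormula M Γ) (x : M.Assign Γ) : ℝ :=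
  φ.form.eval M (M.pair x φ.par)

/-- The value of `φ(x, a)` at a tuple of an extension `j : M → N`. -/
noncomputable def ParamFormula.evalIn {M : Structure.{u, v} L} {α : Type} {Γ : α → L.Sorts}
    (φ : ParamFormula M Γ) (N : Structure.{u, w} L) (j : ∀ s, M.carrier s → N.carrier s)
    (y : N.Assign Γ) : ℝ :=
  φ.form.eval N (N.pair y (fun b => j _ (φ.par b)))

/-- The formula `c · φ(x, a) + d · ψ(x, b)`. -/
def ParamFormula.lin {M : Structure.{u, v} L} {α : Type} {Γ : α → L.Sorts}
    (c d : ℝ) (φ ψ : ParamFormula M Γ) : ParamFormula M Γ where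
  β := φ.β ⊕ ψ.β
  Δ := Sum.elim φ.Δ ψ.Δ
  form := .conn (n := 2) (fun r => c * r 0 + d * r 1)
    (by
      have h0 : UniformContinuous (fun r : Fin 2 → ℝ => r 0) := Pi.uniformContinuous_proj _ 0
      have h1 : UniformContinuous (fun r : Fin 2 → ℝ => r 1) := Pi.uniformContinuous_proj _ 1
      exact (h0.const_smul c).add (h1.const_smul d))
    ![φ.form.subst (fun
        | .inl a => .var (Γ := Sum.elim Γ (Sum.elim φ.Δ ψ.Δ)) (.inl a)
        | .inr b => .var (Γ := Sum.elim Γ (Sum.elim φ.Δ ψ.Δ)) (.inr (.inl b))),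
      ψ.form.subst (fun
        | .inl a => .var (Γ := Sum.elim Γ (Sum.elim φ.Δ ψ.Δ)) (.inl a)
        | .inr b => .var (Γ := Sum.elim Γ (Sum.elim φ.Δ ψ.Δ)) (.inr (.inr b)))]
  par := M.pair φ.par ψ.par

theorem ParamFormula.eval_lin {M : Structure.{u, v} L} {α : Type} {Γ : α → L.Sorts}
    (c d : ℝ) (φ ψ : ParamFormula M Γ) (x : M.Assign Γ) :
    (ParamFormula.lin c d φ ψ).eval x = c * φ.eval x + d * ψ.eval x := by
  simp only [ParamFormula.lin, ParamFormula.eval, Formula.eval, Matrix.cons_val_zero,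
    Matrix.cons_val_one, Formula.eval_subst]
  congr 3 <;>
  · funext a
    rcases a with a | b <;> rfl

/-- The constant formula of value `c`. -/
def ParamFormula.const (M : Structure.{u, v} L) {α : Type} (Γ : α → L.Sorts) (c : ℝ) :
    ParamFormula M Γ where
  β := Empty
  Δ := fun a => a.elim
  form := .conn (n := 0) (fun _ => c) uniformContinuous_const (fun k => k.elim0)
  par := fun a => a.elim

/-- The space of definable predicates in the variables `Γ` with parameters in `M`: the uniform
limits on `M` of formulas with parameters in `M`. -/
def Structure.predicates (M : Structure.{u, v} L) {α : Type} (Γ : α → L.Sorts) :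
    Submodule ℝ (M.Assign Γ → ℝ) where
  carrier := {P | ∀ ε : ℝ, 0 < ε → ∃ φ : ParamFormula M Γ, ∀ x, |P x - φ.eval x| ≤ ε}
  zero_mem' := fun ε hε => ⟨.const M Γ 0, fun x => by
    simp [ParamFormula.const, ParamFormula.eval, Formula.eval, hε.le]⟩
  add_mem' := by
    intro P P' hP hP' ε hε
    obtain ⟨φ, hφ⟩ := hP (ε / 2) (half_pos hε)
    obtain ⟨ψ, hψ⟩ := hP' (ε / 2) (half_pos hε)
    refine ⟨.lin 1 1 φ ψ, fun x => ?_⟩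
    have h1 := abs_le.1 (hφ x)
    have h2 := abs_le.1 (hψ x)
    rw [ParamFormula.eval_lin, Pi.add_apply, abs_le]
    constructor <;> linarith [h1.1, h1.2, h2.1, h2.2]
  smul_mem' := by
    intro c P hP ε hε
    obtain ⟨φ, hφ⟩ := hP (ε / (|c| + 1)) (by positivity)
    refine ⟨.lin c 0 φ φ, fun x => ?_⟩
    have h : (c • P) x - (ParamFormula.lin c 0 φ φ).eval x = c * (P x - φ.eval x) := by
      rw [ParamFormula.eval_lin, Pi.smul_apply, smul_eq_mul]; ring
    rw [h, abs_mul]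
    calc |c| * |P x - φ.eval x| ≤ (|c| + 1) * (ε / (|c| + 1)) := by
          gcongr
          · linarith
          · exact hφ x
      _ = ε := by field_simp

theorem ParamFormula.eval_mem {M : Structure.{u, v} L} {α : Type} {Γ : α → L.Sorts}
    (φ : ParamFormula M Γ) : φ.eval ∈ M.predicates Γ :=
  fun ε hε => ⟨φ, fun x => by simpa using hε.le⟩

theorem Structure.one_mem_predicates (M : Structure.{u, v} L) {α : Type} (Γ : α → L.Sorts) :
    (1 : M.Assign Γ → ℝ) ∈ M.predicates Γ :=
  (ParamFormula.const M Γ 1).eval_mem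

/-- In the elementary extension `j : M → N`, the canonical extension to `N` of the definable
predicate `P` has the value `r` at `y`: some formulas which approximate `P` uniformly on `M` have
values at `y` that converge to `r`. -/
def HasValueIn {M : Structure.{u, v} L} {α : Type} {Γ : α → L.Sorts} (P : M.Assign Γ → ℝ)
    (N : Structure.{u, w} L) (j : ∀ s, M.carrier s → N.carrier s) (y : N.Assign Γ) (r : ℝ) :
    Prop :=
  ∀ ε : ℝ, 0 < ε → ∃ φ : ParamFormula M Γ,
    (∀ x, |P x - φ.eval x| ≤ ε) ∧ |r - φ.evalIn N j y| ≤ ε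

/-- A partial type over `M`: a consistent set of definable predicates with parameters in `M`, that
is, one whose members vanish simultaneously at some tuple of an elementary extension of `M`. -/
def IsPartialType (M : Structure.{u, v} L) {α : Type} (Γ : α → L.Sorts)
    (p : Set (M.predicates Γ)) : Prop :=
  ∃ (N : Structure.{u, v} L) (j : ∀ s, M.carrier s → N.carrier s) (y : N.Assign Γ),
    IsElementary M N j ∧ ∀ P ∈ p, HasValueIn (P : M.Assign Γ → ℝ) N j y 0

/-- A complete type over `M`: a maximal consistent set of definable predicates. -/
def IsCompleteType (M : Structure.{u, v} L) {α : Type} (Γ : α → L.Sorts)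
    (p : Set (M.predicates Γ)) : Prop :=
  Maximal (IsPartialType M Γ) p

/-! ### Definable groups and definable amenability -/

/-- The data defining a group `G` in models of `T`: a definable predicate `D` of `n` variables,
meant to be the distance to `G`, and a definable predicate `Q` with `Q(g, h, k) = d(g h, k)`. -/
structure GroupPredicates (T : Theory L) where
  n : ℕ
  Γ : Fin n → L.Sorts
  D : DefinablePredicate.{u, v} T Γ
  Q : DefinablePredicate.{u, v} T (Sum.elim Γ (Sum.elim Γ Γ))

variable {T : Theory L}

/-- The set `G(M)`. -/
def GroupPredicates.points (G : GroupPredicates.{u, v} T) (M : Structure.{u, w} L) :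
    Set (M.Assign G.Γ) := {x | G.D.eval M x = 0}

/-- `G` is a definable group in `M`: `D` is the distance to `G(M)` (so that `G(M)` is a definable
set), and `G(M)` has a group structure whose multiplication is defined by `Q`. (The group
structure is determined by `Q`.) -/
structure GroupPredicates.GroupIn (G : GroupPredicates.{u, v} T) (M : Structure.{u, w} L) where
  group : Group (G.points M)
  dist_set : ∀ x : M.Assign G.Γ, G.D.eval M x = Metric.infDist x (G.points M)
  dist_mul : ∀ g h k : G.points M,
    G.Q.eval M (M.pair (g : M.Assign G.Γ) (M.pair (h : M.Assign G.Γ) (k : M.Assign G.Γ))) =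
      dist (g * h) k

/-- Restriction of functions to `G(M)`. -/
def GroupPredicates.restrict (G : GroupPredicates.{u, v} T) (M : Structure.{u, w} L) :
    (M.Assign G.Γ → ℝ) →ₗ[ℝ] (G.points M → ℝ) :=
  LinearMap.funLeft ℝ ℝ (Subtype.val : G.points M → M.Assign G.Γ)

/-- The space of definable predicates on `G(M)` with parameters in `M`. -/
def GroupPredicates.predicatesOn (G : GroupPredicates.{u, v} T) (M : Structure.{u, w} L) :
    Submodule ℝ (G.points M → ℝ) := (M.predicates G.Γ).map (G.restrict M)

/-- The restriction of a definable predicate to `G(M)`. -/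
def GroupPredicates.res (G : GroupPredicates.{u, v} T) (M : Structure.{u, w} L)
    (P : M.predicates G.Γ) : G.predicatesOn M :=
  ⟨G.restrict M P, Submodule.mem_map_of_mem P.2⟩

/-- Means on the space of definable predicates on `G(M)`. -/
structure GroupPredicates.Mean (G : GroupPredicates.{u, v} T) (M : Structure.{u, w} L) where
  toFun : G.predicatesOn M →ₗ[ℝ] ℝ
  nonneg : ∀ f : G.predicatesOn M, (∀ x, 0 ≤ (f : G.points M → ℝ) x) → 0 ≤ toFun f
  map_one : toFun (G.res M ⟨1, M.one_mem_predicates G.Γ⟩) = 1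

/-- The mean `m` is invariant: `m(g · P) = m(P)` where `(g · P)(x) = P(g⁻¹ x)` on `G(M)`. (Every
translate of a definable predicate on `G(M)` is again one, so a `P'` as below always exists.) -/
def GroupPredicates.Mean.Invariant {G : GroupPredicates.{u, v} T} {M : Structure.{u, w} L}
    (H : G.GroupIn M) (m : G.Mean M) : Prop :=
  letI := H.group
  ∀ (g : G.points M) (P P' : G.predicatesOn M),
    (∀ x, (P' : G.points M → ℝ) x = (P : G.points M → ℝ) (g⁻¹ * x)) → m.toFun P' = m.toFun P

/-- The kernel of a mean on `G(M)`, as a set of definable predicates. -/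
def GroupPredicates.Mean.ker {G : GroupPredicates.{u, v} T} {M : Structure.{u, w} L}
    (m : G.Mean M) : Set (M.predicates G.Γ) := {P | m.toFun (G.res M P) = 0}

/-- The mean `m` is (given by) a complete type over `M`. -/
def GroupPredicates.Mean.IsType {G : GroupPredicates.{u, v} T} {M : Structure.{u, w} L}
    (m : G.Mean M) : Prop := IsCompleteType M G.Γ m.ker

/-- `G(M)` is definably amenable. -/
def GroupPredicates.GroupIn.DefinablyAmenable {G : GroupPredicates.{u, v} T}
    {M : Structure.{u, w} L} (H : G.GroupIn M) : Prop :=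
  ∃ m : G.Mean M, m.Invariant H

/-- `G(M)` is extremely definably amenable. -/
def GroupPredicates.GroupIn.ExtremelyDefinablyAmenable {G : GroupPredicates.{u, v} T}
    {M : Structure.{u, w} L} (H : G.GroupIn M) : Prop :=
  ∃ m : G.Mean M, m.Invariant H ∧ m.IsType

/-! ### Ultraproducts -/

/-- The limit of a bounded real family along an ultrafilter. -/
noncomputable def ulim {I : Type w} (U : Ultrafilter I) (f : I → ℝ) : ℝ :=
  limUnder (U : Filter I) f

theorem tendsto_ulim {I : Type w} (U : Ultrafilter I) {f : I → ℝ} {a b : ℝ}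
    (h : ∀ i, f i ∈ Set.Icc a b) : Tendsto f U (𝓝 (ulim U f)) := by
  have hm : ((U.map f : Ultrafilter ℝ) : Filter ℝ) ≤ 𝓟 (Set.Icc a b) := by
    rw [le_principal_iff, Ultrafilter.coe_map]
    exact Filter.mem_map.2 (Filter.univ_mem' h)
  obtain ⟨x, -, hx⟩ := isCompact_Icc.ultrafilter_le_nhds (U.map f) hm
  exact tendsto_nhds_limUnder ⟨x, hx⟩

/-- The product of the carriers of sort `s`, before identifying points at distance zero. -/
def PreUltra {I : Type w} (_U : Ultrafilter I) (M : I → Structure.{u, v} L) (s : L.Sorts) :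
    Type (max w v) := ∀ i, (M i).carrier s

theorem PreUltra.tendsto_dist {I : Type w} (U : Ultrafilter I) (M : I → Structure.{u, v} L)
    {s : L.Sorts} (x y : PreUltra U M s) :
    Tendsto (fun i => dist (x i) (y i)) U (𝓝 (ulim U (fun i => dist (x i) (y i)))) :=
  tendsto_ulim U (fun i => ⟨dist_nonneg, (M i).dist_le_bound s (x i) (y i)⟩)

noncomputable instance {I : Type w} (U : Ultrafilter I) (M : I → Structure.{u, v} L)
    (s : L.Sorts) : PseudoMetricSpace (PreUltra U M s) where
  dist x y := ulim U (fun i => dist (x i) (y i))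
  dist_self x := by
    have h := PreUltra.tendsto_dist U M x x
    simp only [dist_self] at h ⊢
    exact tendsto_nhds_unique h tendsto_const_nhds
  dist_comm x y := by simp only [dist_comm]
  dist_triangle x y z := le_of_tendsto_of_tendsto' (PreUltra.tendsto_dist U M x z)
    ((PreUltra.tendsto_dist U M x y).add (PreUltra.tendsto_dist U M y z))
    (fun i => dist_triangle _ _ _)

/-- The class `[x_i]` in the ultraproduct. -/
noncomputable def ultraMk {I : Type w} (U : Ultrafilter I) (M : I → Structure.{u, v} L) {s : L.Sorts}
    (x : ∀ i, (M i).carrier s) : SeparationQuotient (PreUltra U M s) :=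
  SeparationQuotient.mk (X := PreUltra U M s) x

/-- A representative of an element of the ultraproduct. -/
noncomputable def ultraRep {I : Type w} (U : Ultrafilter I) (M : I → Structure.{u, v} L)
    {s : L.Sorts} (x : SeparationQuotient (PreUltra U M s)) (i : I) : (M i).carrier s :=
  (Function.surjInv SeparationQuotient.surjective_mk x : PreUltra U M s) i

theorem ultraMk_ultraRep {I : Type w} (U : Ultrafilter I) (M : I → Structure.{u, v} L)
    {s : L.Sorts} (x : SeparationQuotient (PreUltra U M s)) : ultraMk U M (ultraRep U M x) = x :=
  Function.surjInv_eq SeparationQuotient.surjective_mk x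

theorem tendsto_dist_ultraMk {I : Type w} (U : Ultrafilter I) (M : I → Structure.{u, v} L)
    {s : L.Sorts} (x y : ∀ i, (M i).carrier s) :
    Tendsto (fun i => dist (x i) (y i)) U (𝓝 (dist (ultraMk U M x) (ultraMk U M y))) :=
  PreUltra.tendsto_dist U M x y

theorem tendsto_dist_ultraRep {I : Type w} (U : Ultrafilter I) (M : I → Structure.{u, v} L)
    {s : L.Sorts} (x y : SeparationQuotient (PreUltra U M s)) :
    Tendsto (fun i => dist (ultraRep U M x i) (ultraRep U M y i)) U (𝓝 (dist x y)) := by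
  have h := tendsto_dist_ultraMk U M (ultraRep U M x) (ultraRep U M y)
  rwa [ultraMk_ultraRep, ultraMk_ultraRep] at h

/-- The metric ultraproduct. Symbols are interpreted on representatives; by uniform continuity
the choice of the representatives does not matter. -/
noncomputable def ultraproduct {I : Type w} (U : Ultrafilter I) (M : I → Structure.{u, v} L) :
    Structure.{u, max w v} L where
  carrier s := SeparationQuotient (PreUltra U M s)
  metric s := inferInstance
  nonempty s := ⟨ultraMk U M (fun _ => Classical.arbitrary _)⟩
  dist_le_bound s x y := le_of_tendsto' (tendsto_dist_ultraRep U M x y)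
    (fun i => (M i).dist_le_bound s _ _)
  funMap f x := ultraMk U M (fun i => (M i).funMap f (fun k => ultraRep U M (x k) i))
  funMap_unif f k ε hε x y hxy hk := by
    refine le_of_tendsto (tendsto_dist_ultraMk U M _ _) ?_
    filter_upwards [(tendsto_dist_ultraRep U M (x k) (y k)).eventually_lt_const hk] with i hi
    exact (M i).funMap_unif f k ε hε _ _ (fun l hl => by rw [hxy l hl]) hi
  relMap R x := ulim U (fun i => (M i).relMap R (fun k => ultraRep U M (x k) i))
  relMap_mem R x := isClosed_Icc.mem_of_tendsto
    (tendsto_ulim U (fun i => (M i).relMap_mem R (fun k => ultraRep U M (x k) i)))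
    (Eventually.of_forall (fun i => (M i).relMap_mem R _))
  relMap_unif R k ε hε x y hxy hk := by
    have hx := tendsto_ulim U (fun i => (M i).relMap_mem R (fun k => ultraRep U M (x k) i))
    have hy := tendsto_ulim U (fun i => (M i).relMap_mem R (fun k => ultraRep U M (y k) i))
    refine le_of_tendsto (hx.sub hy).abs ?_
    filter_upwards [(tendsto_dist_ultraRep U M (x k) (y k)).eventually_lt_const hk] with i hi
    exact (M i).relMap_unif R k ε hε _ _ (fun l hl => by rw [hxy l hl]) hi

/-- The tuple `[a_i]` of the ultraproduct. -/
noncomputable def ultraTuple {I : Type w} (U : Ultrafilter I) (M : I → Structure.{u, v} L) {α : Type}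
    {Γ : α → L.Sorts} (a : ∀ i, (M i).Assign Γ) : (ultraproduct U M).Assign Γ :=
  fun k => ultraMk U M (fun i => a i k)

/-- The restriction to `G(M)` of the predicate defined by the formula `φ(x, a)`. -/
noncomputable def GroupPredicates.formulaOn (G : GroupPredicates.{u, v} T)
    (M : Structure.{u, w} L) {β : Type} {Δ : β → L.Sorts} (φ : Formula L (Sum.elim G.Γ Δ))
    (a : M.Assign Δ) : G.predicatesOn M :=
  G.res M ⟨(ParamFormula.mk φ a).eval, (ParamFormula.mk φ a).eval_mem⟩

/-- The mean `m'` on `G(∏_U M_i)` is the ultralimit of the means `m i` on `G(M_i)`: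
`m'(φ(x, [a_i])) = lim_U (m i)(φ(x, a_i))` for all formulas `φ` and parameters `a_i`. -/
def GroupPredicates.Mean.IsUltralimit {G : GroupPredicates.{u, v} T} {I : Type w}
    (U : Ultrafilter I) {M : I → Structure.{u, v} L} (m : ∀ i, G.Mean (M i))
    (m' : G.Mean (ultraproduct U M)) : Prop :=
  ∀ (β : Type) (Δ : β → L.Sorts) (φ : Formula L (Sum.elim G.Γ Δ)) (a : ∀ i, (M i).Assign Δ),
    Tendsto (fun i => (m i).toFun (G.formulaOn (M i) φ (a i))) U
      (𝓝 (m'.toFun (G.formulaOn (ultraproduct U M) φ (ultraTuple U M a))))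

end MetricLanguage

open MetricLanguage

namespace MetricLanguage

variable {L : MetricLanguage.{u}} {T : Theory L}

/-! ### Uniform continuity and boundedness -/

/-! Everything rests on the theorem of Łoś, `Formula.tendsto_eval`: the value of a formula at a
tuple `[a_i]` of the ultraproduct is the ultralimit of its values at the `a_i`. Since `T`-definable
predicates are approximated by formulas uniformly over models of `T`, the same holds for `D` and
`Q`. If `D([x_i]) = 0` then the distance from `x_i` to `G(M_i)` tends to `0`, so the `x_i` may be
replaced by points of `G(M_i)`. Thus `G(∏_U M_i)` consists of the classes of families of points of
the `G(M_i)` (`ultraPoint_surjective`), and convergence of `Q` makes the coordinatewise product well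
defined on classes.

For the means, a definable predicate `f` on `G(∏_U M_i)` is approximated within `ε` by families
`p_i` of predicates on the `G(M_i)`. Closeness along every family of points is closeness uniform on
`G(M_i)` for almost all `i`, and means are 1-Lipschitz for the supremum norm; so the numbers
`m_i(p_i)` determine a value at `f` as `ε` tends to `0`. Linearity, positivity and normalization
pass to this value, and density of the formulas gives uniqueness.

Invariance follows by translating each `p_i` by `g_i`, once translates of definable predicates are
known to be definable predicates. A translate `φ(g⁻¹ x)` is approximated on `G(M)` by minimizing
over `y` the sum of `φ(y)` and penalties for `y` being far from `G` or `g y` far from `x`; uniform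
limits on `G(M)` then extend to all of `M`.

For types, `P - m(P)·1` always lies in the kernel of `m`, so a tuple realizing the kernel gives each
`P` the value `m(P)`. Hence a consistent kernel is automatically maximal. If `y_i` realizes the
kernel of `m_i` in `N_i`, then by Łoś `[y_i]` realizes the kernel of the ultralimit in `∏_U N_i`. -/

theorem exists_pos_forall_le {ι : Type*} [Finite ι] (f : ι → ℝ) (hf : ∀ k, 0 < f k) :
    ∃ δ : ℝ, 0 < δ ∧ ∀ k, δ ≤ f k := by
  have h : ∀ᶠ δ in 𝓝[>] (0 : ℝ), ∀ k, δ ≤ f k :=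
    eventually_all.2 fun k => (eventually_le_nhds (hf k)).filter_mono nhdsWithin_le_nhds
  obtain ⟨δ, hδ, h0⟩ := (h.and self_mem_nhdsWithin).exists
  exact ⟨δ, h0, hδ⟩

/-- The coordinates in `s` are changed from `x` to `y` one at a time, each at cost `η`. -/
theorem dist_le_card_mul {ι : Type*} [DecidableEq ι] {X : ι → Type*}
    [∀ k, PseudoMetricSpace (X k)] {Y : Type*} [PseudoMetricSpace Y] (g : (∀ k, X k) → Y)
    {δ η : ℝ} (h : ∀ k (x y : ∀ k, X k), (∀ l, l ≠ k → x l = y l) → dist (x k) (y k) < δ →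
      dist (g x) (g y) ≤ η) (s : Finset ι) :
    ∀ x y : ∀ k, X k, (∀ k, k ∉ s → x k = y k) → (∀ k, dist (x k) (y k) < δ) →
      dist (g x) (g y) ≤ s.card * η := by
  induction s using Finset.induction_on with
  | empty =>
    intro x y hxy _
    rw [funext fun k => hxy k (Finset.notMem_empty k)]
    simp
  | insert a s ha ih =>
    intro x y hxy hd
    have h1 : dist (g x) (g (Function.update x a (y a))) ≤ η := by
      refine h a _ _ (fun l hl => ?_) ?_
      · rw [Function.update_of_ne hl]
      · rw [Function.update_self]; exact hd a
    have h2 : dist (g (Function.update x a (y a))) (g y) ≤ s.card * η := by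
      refine ih _ _ (fun k hk => ?_) (fun k => ?_)
      · by_cases hka : k = a
        · subst hka; rw [Function.update_self]
        · rw [Function.update_of_ne hka]
          exact hxy k (by simp [hka, hk])
      · by_cases hka : k = a
        · subst hka; rw [Function.update_self, dist_self]
          exact dist_nonneg.trans_lt (hd k)
        · rw [Function.update_of_ne hka]; exact hd k
    rw [Finset.card_insert_of_notMem ha]
    push_cast
    linarith [dist_triangle (g x) (g (Function.update x a (y a))) (g y)]

/-- A joint modulus from moduli in the separate arguments; it depends on these only. -/
theorem exists_joint_modulus {n : ℕ} (md : Fin n → ℝ → ℝ)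
    (hmd : ∀ k ε, 0 < ε → 0 < md k ε) {ε : ℝ} (hε : 0 < ε) :
    ∃ δ : ℝ, 0 < δ ∧ ∀ (X : Fin n → Type v) [∀ k, PseudoMetricSpace (X k)] (Y : Type w)
      [PseudoMetricSpace Y] (g : (∀ k, X k) → Y),
      (∀ (k : Fin n) (ε : ℝ), 0 < ε → ∀ x y : ∀ k, X k, (∀ l, l ≠ k → x l = y l) →
        dist (x k) (y k) < md k ε → dist (g x) (g y) ≤ ε) →
      ∀ x y : ∀ k, X k, (∀ k, dist (x k) (y k) < δ) → dist (g x) (g y) ≤ ε := by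
  -- The denominator `n + 1` also serves symbols of arity `0`; the total cost is `n · ε / (n + 1) ≤
  -- ε`.
  have hη : 0 < ε / (n + 1) := by positivity
  obtain ⟨δ, hδ, hle⟩ := exists_pos_forall_le _ (fun k => hmd k _ hη)
  refine ⟨δ, hδ, fun X _ Y _ g hg x y hxy => ?_⟩
  have h := dist_le_card_mul g (fun k x y h1 h2 => hg k _ hη x y h1 (h2.trans_le (hle k)))
    Finset.univ x y (fun k hk => absurd (Finset.mem_univ k) hk) hxy
  refine h.trans ?_
  rw [Finset.card_univ, Fintype.card_fin, mul_div_assoc', div_le_iff₀ (by positivity)]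
  nlinarith

/-- The point is that `δ` is chosen before the structure: in an ultraproduct it has to serve all
factors at once. -/
theorem exists_funMap_modulus (f : L.Fun) {ε : ℝ} (hε : 0 < ε) :
    ∃ δ : ℝ, 0 < δ ∧ ∀ (M : Structure.{u, v} L) (x y : ∀ k, M.carrier (L.funDom f k)),
      (∀ k, dist (x k) (y k) < δ) → dist (M.funMap f x) (M.funMap f y) ≤ ε := by
  obtain ⟨δ, hδ, h⟩ := exists_joint_modulus.{v, v} (L.funMod f) (L.funMod_pos f) hε
  exact ⟨δ, hδ, fun M => h _ _ (M.funMap f) (M.funMap_unif f)⟩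

theorem exists_relMap_modulus (R : L.Rel) {ε : ℝ} (hε : 0 < ε) :
    ∃ δ : ℝ, 0 < δ ∧ ∀ (M : Structure.{u, v} L) (x y : ∀ k, M.carrier (L.relDom R k)),
      (∀ k, dist (x k) (y k) < δ) → |M.relMap R x - M.relMap R y| ≤ ε := by
  obtain ⟨δ, hδ, h⟩ := exists_joint_modulus.{v, 0} (L.relMod R) (L.relMod_pos R) hε
  exact ⟨δ, hδ, fun M => h _ ℝ (M.relMap R) (M.relMap_unif R)⟩

theorem Term.exists_modulus (M : Structure.{u, v} L) {α : Type} {Γ : α → L.Sorts} {s : L.Sorts}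
    (t : Term L Γ s) {ε : ℝ} (hε : 0 < ε) :
    ∃ δ : ℝ, 0 < δ ∧ ∀ x y : M.Assign Γ, (∀ a, dist (x a) (y a) < δ) →
      dist (t.eval M x) (t.eval M y) < ε := by
  induction t generalizing ε with
  | var a => exact ⟨ε, hε, fun x y h => h a⟩
  | app f t ih =>
    obtain ⟨η, hη, h⟩ := exists_funMap_modulus.{u, v} f (half_pos hε)
    choose δ' hδ' h' using fun k => ih k hη
    obtain ⟨δ, hδ, hle⟩ := exists_pos_forall_le δ' hδ'
    refine ⟨δ, hδ, fun x y hxy => (h M _ _ fun k => h' k x y fun a => ?_).trans_lt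
      (half_lt_self hε)⟩
    exact (hxy a).trans_le (hle k)

/-- Induction on the formula; a connective is bounded on the compact box given by the bounds of its
arguments. Uniformity over structures is what makes ultralimits of values and of means exist. -/
theorem Formula.exists_bound {α : Type} {Γ : α → L.Sorts} (φ : Formula L Γ) :
    ∃ B : ℝ, ∀ (M : Structure.{u, v} L) (x : M.Assign Γ), |φ.eval M x| ≤ B := by
  induction φ with
  | @distEq α Γ s t t' =>
    refine ⟨L.bound s, fun M x => ?_⟩
    simp only [Formula.eval, abs_of_nonneg dist_nonneg]
    exact M.dist_le_bound _ _ _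
  | rel R t =>
    refine ⟨max |L.relLo R| |L.relHi R|, fun M x => ?_⟩
    have h := M.relMap_mem R (fun k => (t k).eval M x)
    exact abs_le_max_abs_abs h.1 h.2
  | conn c hc φ ih =>
    choose B hB using ih
    obtain ⟨C, hC⟩ := (isCompact_univ_pi fun k =>
      isCompact_Icc (a := -B k) (b := B k)).exists_bound_of_continuousOn hc.continuous.continuousOn
    exact ⟨C, fun M x => hC _ (fun k _ => abs_le.1 (hB k M x))⟩
  | inf s φ ih =>
    obtain ⟨B, hB⟩ := ih
    refine ⟨B, fun M x => abs_le.2 ⟨le_ciInf fun y => (abs_le.1 (hB M _)).1, ?_⟩⟩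
    exact (ciInf_le ⟨-B, by rintro _ ⟨y, rfl⟩; exact (abs_le.1 (hB M _)).1⟩
      (Classical.arbitrary _)).trans (abs_le.1 (hB M _)).2
  | sup s φ ih =>
    obtain ⟨B, hB⟩ := ih
    refine ⟨B, fun M x => abs_le.2 ⟨?_, ciSup_le fun y => (abs_le.1 (hB M _)).2⟩⟩
    exact (abs_le.1 (hB M _)).1.trans
      (le_ciSup (f := fun y => φ.eval M (M.cons y x))
        ⟨B, by rintro _ ⟨y, rfl⟩; exact (abs_le.1 (hB M _)).2⟩ (Classical.arbitrary _))

theorem Formula.isGLB_inf (M : Structure.{u, v} L) {α : Type} {Γ : α → L.Sorts} {s : L.Sorts}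
    (φ : Formula L (extCtx Γ s)) (x : M.Assign Γ) :
    IsGLB (Set.range fun y => φ.eval M (M.cons y x)) ((Formula.inf s φ).eval M x) := by
  obtain ⟨B, hB⟩ := φ.exists_bound
  exact isGLB_ciInf ⟨-B, by rintro _ ⟨y, rfl⟩; exact (abs_le.1 (hB M _)).1⟩

theorem Formula.isLUB_sup (M : Structure.{u, v} L) {α : Type} {Γ : α → L.Sorts} {s : L.Sorts}
    (φ : Formula L (extCtx Γ s)) (x : M.Assign Γ) :
    IsLUB (Set.range fun y => φ.eval M (M.cons y x)) ((Formula.sup s φ).eval M x) := by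
  obtain ⟨B, hB⟩ := φ.exists_bound
  exact isLUB_ciSup ⟨B, by rintro _ ⟨y, rfl⟩; exact (abs_le.1 (hB M _)).2⟩

theorem abs_sub_le_of_isGLB {ι : Type*} {f g : ι → ℝ} {a b ε : ℝ}
    (ha : IsGLB (Set.range f) a) (hb : IsGLB (Set.range g) b) (h : ∀ y, |f y - g y| ≤ ε) :
    |a - b| ≤ ε := by
  have h1 : a - ε ≤ b := hb.2 (by
    rintro _ ⟨y, rfl⟩
    linarith [ha.1 ⟨y, rfl⟩, (abs_le.1 (h y)).2])
  have h2 : b - ε ≤ a := ha.2 (by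
    rintro _ ⟨y, rfl⟩
    linarith [hb.1 ⟨y, rfl⟩, (abs_le.1 (h y)).1])
  exact abs_le.2 ⟨by linarith, by linarith⟩

theorem abs_sub_le_of_isLUB {ι : Type*} {f g : ι → ℝ} {a b ε : ℝ}
    (ha : IsLUB (Set.range f) a) (hb : IsLUB (Set.range g) b) (h : ∀ y, |f y - g y| ≤ ε) :
    |a - b| ≤ ε := by
  have h1 : a ≤ b + ε := ha.2 (by
    rintro _ ⟨y, rfl⟩
    linarith [hb.1 ⟨y, rfl⟩, (abs_le.1 (h y)).2])
  have h2 : b ≤ a + ε := hb.2 (by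
    rintro _ ⟨y, rfl⟩
    linarith [ha.1 ⟨y, rfl⟩, (abs_le.1 (h y)).1])
  exact abs_le.2 ⟨by linarith, by linarith⟩

theorem dist_cons_lt (M : Structure.{u, v} L) {α : Type} {Γ : α → L.Sorts} {s : L.Sorts}
    (z : M.carrier s) {x y : M.Assign Γ} {δ : ℝ} (hδ : 0 < δ) (h : ∀ a, dist (x a) (y a) < δ) :
    ∀ o, dist (M.cons z x o) (M.cons z y o) < δ
  | none => (dist_self z).trans_lt hδ
  | some a => h a

theorem Formula.exists_modulus (M : Structure.{u, v} L) {α : Type} {Γ : α → L.Sorts}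
    (φ : Formula L Γ) {ε : ℝ} (hε : 0 < ε) :
    ∃ δ : ℝ, 0 < δ ∧ ∀ x y : M.Assign Γ, (∀ a, dist (x a) (y a) < δ) →
      |φ.eval M x - φ.eval M y| ≤ ε := by
  induction φ generalizing ε with
  | distEq t t' =>
    obtain ⟨δ₁, h₁, h₁'⟩ := t.exists_modulus M (half_pos hε)
    obtain ⟨δ₂, h₂, h₂'⟩ := t'.exists_modulus M (half_pos hε)
    refine ⟨min δ₁ δ₂, lt_min h₁ h₂, fun x y h => ?_⟩
    have e₁ := h₁' x y fun a => (h a).trans_le (min_le_left _ _)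
    have e₂ := h₂' x y fun a => (h a).trans_le (min_le_right _ _)
    have := dist_dist_dist_le (t.eval M x) (t'.eval M x) (t.eval M y) (t'.eval M y)
    rw [Real.dist_eq] at this
    exact this.trans (by linarith)
  | rel R t =>
    obtain ⟨η, hη, h⟩ := exists_relMap_modulus.{u, v} R hε
    choose δ' hδ' h' using fun k => (t k).exists_modulus M hη
    obtain ⟨δ, hδ, hle⟩ := exists_pos_forall_le δ' hδ'
    exact ⟨δ, hδ, fun x y hxy => h M _ _ fun k => h' k x y fun a => (hxy a).trans_le (hle k)⟩
  | conn c hc φ ih =>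
    obtain ⟨η, hη, h⟩ := Metric.uniformContinuous_iff.1 hc ε hε
    choose δ' hδ' h' using fun k => ih k (half_pos hη)
    obtain ⟨δ, hδ, hle⟩ := exists_pos_forall_le δ' hδ'
    refine ⟨δ, hδ, fun x y hxy => (h ((dist_pi_lt_iff hη).2 fun k => ?_)).le⟩
    exact (h' k x y fun a => (hxy a).trans_le (hle k)).trans_lt (half_lt_self hη)
  | inf s φ ih =>
    obtain ⟨δ, hδ, h⟩ := ih hε
    exact ⟨δ, hδ, fun x y hxy => abs_sub_le_of_isGLB (φ.isGLB_inf M x) (φ.isGLB_inf M y)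
      fun z => h _ _ (dist_cons_lt M z hδ hxy)⟩
  | sup s φ ih =>
    obtain ⟨δ, hδ, h⟩ := ih hε
    exact ⟨δ, hδ, fun x y hxy => abs_sub_le_of_isLUB (φ.isLUB_sup M x) (φ.isLUB_sup M y)
      fun z => h _ _ (dist_cons_lt M z hδ hxy)⟩

/-! ### The theorem of Łoś -/

section Los

variable {I : Type w} (U : Ultrafilter I) (M : I → Structure.{u, v} L)

theorem ultraMk_eq_iff {s : L.Sorts} (x y : ∀ i, (M i).carrier s) :
    ultraMk U M x = ultraMk U M y ↔ Tendsto (fun i => dist (x i) (y i)) U (𝓝 0) := by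
  have h := tendsto_dist_ultraMk U M x y
  rw [← dist_eq_zero]
  exact ⟨fun h0 => h0 ▸ h, fun h0 => tendsto_nhds_unique h h0⟩

theorem eventually_dist_ultraRep_lt {s : L.Sorts} (x : ∀ i, (M i).carrier s) {δ : ℝ}
    (hδ : 0 < δ) : ∀ᶠ i in (U : Filter I), dist (ultraRep U M (ultraMk U M x) i) (x i) < δ :=
  ((ultraMk_eq_iff U M _ _).1 (ultraMk_ultraRep U M (ultraMk U M x))).eventually_lt_const hδ

/-- The representatives chosen in `ultraproduct` are eventually as close as desired to the given
ones, and one modulus of `f` is valid in every factor. -/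
theorem funMap_ultraMk (f : L.Fun) (x : ∀ i k, (M i).carrier (L.funDom f k)) :
    (ultraproduct U M).funMap f (fun k => ultraMk U M fun i => x i k) =
      ultraMk U M fun i => (M i).funMap f (x i) := by
  refine (ultraMk_eq_iff U M _ _).2 (Metric.tendsto_nhds.2 fun ε hε => ?_)
  obtain ⟨δ, hδ, h⟩ := exists_funMap_modulus.{u, v} f (half_pos hε)
  filter_upwards [eventually_all.2 fun k =>
    eventually_dist_ultraRep_lt U M (fun i => x i k) hδ] with i hi
  rw [Real.dist_eq, sub_zero, abs_of_nonneg dist_nonneg]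
  exact (h (M i) _ _ hi).trans_lt (half_lt_self hε)

theorem tendsto_relMap (R : L.Rel) (x : ∀ i k, (M i).carrier (L.relDom R k)) :
    Tendsto (fun i => (M i).relMap R (x i)) U
      (𝓝 ((ultraproduct U M).relMap R (fun k => ultraMk U M fun i => x i k))) := by
  have h := tendsto_ulim U fun i => (M i).relMap_mem R
    (fun k => ultraRep U M (ultraMk U M fun i => x i k) i)
  refine h.congr_dist (Metric.tendsto_nhds.2 fun ε hε => ?_)
  obtain ⟨δ, hδ, h⟩ := exists_relMap_modulus.{u, v} R (half_pos hε)
  filter_upwards [eventually_all.2 fun k =>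
    eventually_dist_ultraRep_lt U M (fun i => x i k) hδ] with i hi
  rw [Real.dist_eq, sub_zero, abs_of_nonneg dist_nonneg]
  exact (h (M i) _ _ hi).trans_lt (half_lt_self hε)

theorem Term.eval_ultraTuple {α : Type} {Γ : α → L.Sorts} {s : L.Sorts} (t : Term L Γ s)
    (a : ∀ i, (M i).Assign Γ) : t.eval (ultraproduct U M) (ultraTuple U M a) =
      ultraMk U M fun i => t.eval (M i) (a i) := by
  induction t with
  | var a => rfl
  | app f t ih =>
    simp only [Term.eval, ih]
    exact funMap_ultraMk U M f fun i k => (t k).eval (M i) (a i)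

theorem cons_ultraTuple {α : Type} {Γ : α → L.Sorts} {s : L.Sorts} (a : ∀ i, (M i).Assign Γ)
    (x : ∀ i, (M i).carrier s) : (ultraproduct U M).cons (ultraMk U M x) (ultraTuple U M a) =
      ultraTuple U M fun i => (M i).cons (x i) (a i) := by
  funext o
  cases o <;> rfl

theorem pair_ultraTuple {α β : Type} {Γ : α → L.Sorts} {Δ : β → L.Sorts}
    (a : ∀ i, (M i).Assign Γ) (b : ∀ i, (M i).Assign Δ) :
    (ultraproduct U M).pair (ultraTuple U M a) (ultraTuple U M b) =
      ultraTuple U M fun i => (M i).pair (a i) (b i) := by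
  funext o
  cases o <;> rfl

theorem ultraTuple_ultraRep {α : Type} {Γ : α → L.Sorts} (x : (ultraproduct U M).Assign Γ) :
    ultraTuple U M (fun i a => ultraRep U M (x a) i) = x :=
  funext fun a => ultraMk_ultraRep U M (x a)

/-- Quantifiers commute with ultralimits. -/
theorem tendsto_of_isGLB {X : I → Type*} {Y : Type*} (mk : (∀ i, X i) → Y)
    (hmk : Function.Surjective mk) {f : ∀ i, X i → ℝ} {g : Y → ℝ} {a : I → ℝ} {b : ℝ}
    (hf : ∀ i, IsGLB (Set.range (f i)) (a i)) (hg : IsGLB (Set.range g) b)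
    (h : ∀ x : ∀ i, X i, Tendsto (fun i => f i (x i)) U (𝓝 (g (mk x)))) :
    Tendsto a U (𝓝 b) := by
  have hlt : ∀ c, b < c → ∀ᶠ i in (U : Filter I), a i < c := by
    intro c hc
    obtain ⟨_, ⟨y, rfl⟩, -, hy⟩ := hg.exists_between hc
    obtain ⟨x, rfl⟩ := hmk y
    filter_upwards [(h x).eventually_lt_const hy] with i hi
    exact ((hf i).1 ⟨x i, rfl⟩).trans_lt hi
  have hgt : ∀ c, c < b → ∀ᶠ i in (U : Filter I), c < a i := by
    intro c hc
    -- Near-minimizers `x i` form an element `mk x`, where `g` is at least `b > (b + c) / 2`; the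
    -- loss of `(b - c) / 2` then leaves `a i` above `c`.
    have hex : ∀ i, ∃ x, f i x < a i + (b - c) / 2 := fun i => by
      obtain ⟨_, ⟨y, rfl⟩, -, hy⟩ :=
        (hf i).exists_between (lt_add_of_pos_right (a i) (half_pos (sub_pos.2 hc)))
      exact ⟨y, hy⟩
    choose x hx using hex
    have hb : b ≤ g (mk x) := hg.1 ⟨mk x, rfl⟩
    filter_upwards [(h x).eventually_const_lt (show (b + c) / 2 < g (mk x) by linarith)]
      with i hi
    linarith [hx i]
  exact tendsto_order.2 ⟨hgt, hlt⟩

theorem _root_.IsLUB.neg_range {Z : Type*} {k : Z → ℝ} {c : ℝ} (hk : IsLUB (Set.range k) c) :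
    IsGLB (Set.range fun z => -k z) (-c) := by
  refine ⟨?_, fun d hd => le_neg.2 (hk.2 ?_)⟩
  · rintro _ ⟨z, rfl⟩
    exact neg_le_neg (hk.1 ⟨z, rfl⟩)
  · rintro _ ⟨z, rfl⟩
    exact le_neg.2 (hd ⟨z, rfl⟩)

theorem tendsto_of_isLUB {X : I → Type*} {Y : Type*} (mk : (∀ i, X i) → Y)
    (hmk : Function.Surjective mk) {f : ∀ i, X i → ℝ} {g : Y → ℝ} {a : I → ℝ} {b : ℝ}
    (hf : ∀ i, IsLUB (Set.range (f i)) (a i)) (hg : IsLUB (Set.range g) b)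
    (h : ∀ x : ∀ i, X i, Tendsto (fun i => f i (x i)) U (𝓝 (g (mk x)))) :
    Tendsto a U (𝓝 b) := by
  simpa using (tendsto_of_isGLB U mk hmk (f := fun i x => -f i x) (g := fun y => -g y)
    (fun i => (hf i).neg_range) hg.neg_range (fun x => (h x).neg)).neg

theorem ultraMk_surjective (s : L.Sorts) : Function.Surjective
    (ultraMk U M : (∀ i, (M i).carrier s) → (ultraproduct U M).carrier s) :=
  fun x => ⟨ultraRep U M x, ultraMk_ultraRep U M x⟩

/-- Induction on the formula: atomic formulas by uniform continuity of the symbols, connectives by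
continuity, quantifiers by choosing nearly optimal witnesses in the factors. -/
theorem Formula.tendsto_eval {α : Type} {Γ : α → L.Sorts} (φ : Formula L Γ)
    (a : ∀ i, (M i).Assign Γ) : Tendsto (fun i => φ.eval (M i) (a i)) U
      (𝓝 (φ.eval (ultraproduct U M) (ultraTuple U M a))) := by
  induction φ with
  | distEq t t' =>
    simp only [Formula.eval, Term.eval_ultraTuple]
    exact tendsto_dist_ultraMk U M _ _
  | rel R t =>
    simp only [Formula.eval, Term.eval_ultraTuple]
    exact tendsto_relMap U M R fun i k => (t k).eval (M i) (a i)
  | conn c hc φ ih =>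
    exact (hc.continuous.tendsto _).comp (tendsto_pi_nhds.2 fun k => ih k a)
  | inf s φ ih =>
    refine tendsto_of_isGLB U (ultraMk U M) (ultraMk_surjective U M s)
      (fun i => φ.isGLB_inf (M i) (a i)) (φ.isGLB_inf (ultraproduct U M) _)
      (fun x => ?_)
    rw [cons_ultraTuple]
    exact ih _
  | sup s φ ih =>
    refine tendsto_of_isLUB U (ultraMk U M) (ultraMk_surjective U M s)
      (fun i => φ.isLUB_sup (M i) (a i)) (φ.isLUB_sup (ultraproduct U M) _)
      (fun x => ?_)
    rw [cons_ultraTuple]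
    exact ih _

end Los

/-! ### Infima over tuples -/

/-- The infimum over the variables of a finite context is a formula. -/
theorem Formula.exists_infTuple {n : ℕ} {β : Type} {Γ : Fin n → L.Sorts} {Δ : β → L.Sorts}
    (φ : Formula L (Sum.elim Γ Δ)) :
    ∃ ψ : Formula L Δ, ∀ (M : Structure.{u, v} L) (d : M.Assign Δ),
      IsGLB (Set.range fun x : M.Assign Γ => φ.eval M (M.pair x d)) (ψ.eval M d) := by
  induction n with
  | zero =>
    let σ : ∀ a, Term L Δ (Sum.elim Γ Δ a)
      | .inl a => a.elim0
      | .inr b => .var b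
    refine ⟨φ.subst σ, fun M d => ?_⟩
    have h : ∀ x : M.Assign Γ, φ.eval M (M.pair x d) = (φ.subst σ).eval M d := fun x => by
      rw [Formula.eval_subst]
      congr 1
      funext a
      rcases a with a | b
      · exact a.elim0
      · rfl
    simp only [h]
    have : Nonempty (M.Assign Γ) := ⟨fun a => a.elim0⟩
    rw [Set.range_const]
    exact isGLB_singleton
  | succ n ih =>
    let Γ' : Fin n → L.Sorts := fun i => Γ i.succ
    -- The first variable becomes the bound variable of an `inf`; the other `n` are left to the
    -- induction hypothesis.
    let σ : ∀ a, Term L (extCtx (Sum.elim Γ' Δ) (Γ 0)) (Sum.elim Γ Δ a)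
      | .inl a => Fin.cases (motive := fun a => Term L (extCtx (Sum.elim Γ' Δ) (Γ 0)) (Γ a))
          (.var (Γ := extCtx (Sum.elim Γ' Δ) (Γ 0)) none)
          (fun i => .var (Γ := extCtx (Sum.elim Γ' Δ) (Γ 0)) (some (.inl i))) a
      | .inr b => .var (Γ := extCtx (Sum.elim Γ' Δ) (Γ 0)) (some (.inr b))
    obtain ⟨ψ, hψ⟩ := ih (.inf (Γ 0) (φ.subst σ))
    refine ⟨ψ, fun M d => ?_⟩
    have h : ∀ x : M.Assign Γ, φ.eval M (M.pair x d) =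
        (φ.subst σ).eval M (M.cons (x 0) (M.pair (fun i => x i.succ : M.Assign Γ') d)) := by
      intro x
      rw [Formula.eval_subst]
      congr 1
      funext a
      rcases a with a | b
      · refine Fin.cases ?_ (fun i => ?_) a <;> rfl
      · rfl
    refine ⟨?_, fun c hc => (hψ M d).2 ?_⟩
    · rintro _ ⟨x, rfl⟩
      simp only [h]
      exact ((hψ M d).1 ⟨_, rfl⟩).trans ((Formula.isGLB_inf M (φ.subst σ) _).1 ⟨_, rfl⟩)
    · rintro _ ⟨y, rfl⟩
      refine (Formula.isGLB_inf M (φ.subst σ) _).2 ?_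
      rintro _ ⟨z, rfl⟩
      have := hc ⟨(Fin.cons z y : ∀ a, M.carrier (Γ a)), rfl⟩
      simp only [h] at this
      exact this

/-! ### Values of definable predicates -/

/-- The Cauchy estimate at `x` is a hypothesis because `N` may lie in a universe to which `P.cauchy`
does not apply. -/
theorem DefinablePredicate.tendsto_seq_eval {α : Type} {Γ : α → L.Sorts}
    (P : DefinablePredicate.{u, v} T Γ) (N : Structure.{u, w} L) (x : N.Assign Γ)
    (h : ∀ ε : ℝ, 0 < ε → ∃ K : ℕ, ∀ k l, K ≤ k → K ≤ l →
      |(P.seq k).eval N x - (P.seq l).eval N x| ≤ ε) :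
    Tendsto (fun k => (P.seq k).eval N x) atTop (𝓝 (P.eval N x)) := by
  have hc : CauchySeq fun k => (P.seq k).eval N x := by
    refine Metric.cauchySeq_iff.2 fun ε hε => ?_
    obtain ⟨K, hK⟩ := h (ε / 2) (half_pos hε)
    exact ⟨K, fun k hk l hl => (hK k l hk hl).trans_lt (half_lt_self hε)⟩
  exact hc.tendsto_limUnder

/-- A formula approximating a definable predicate uniformly in all models of the theory which
belong to the universe of the predicate, and in their ultraproducts. -/
theorem DefinablePredicate.exists_formula {α : Type} {Γ : α → L.Sorts}
    (P : DefinablePredicate.{u, v} T Γ) {ε : ℝ} (hε : 0 < ε) : ∃ φ : Formula L Γ,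
      (∀ M : Structure.{u, v} L, M.Models T → ∀ x : M.Assign Γ, |φ.eval M x - P.eval M x| ≤ ε) ∧
      ∀ (I : Type w) (U : Ultrafilter I) (M : I → Structure.{u, v} L), (∀ i, (M i).Models T) →
        ∀ x : (ultraproduct U M).Assign Γ,
          |φ.eval (ultraproduct U M) x - P.eval (ultraproduct U M) x| ≤ ε := by
  obtain ⟨K, hK⟩ := P.cauchy ε hε
  -- The ultraproduct may live in a larger universe than the structures of `P.cauchy`, so Łoś
  -- carries the estimate over from the factors.
  have hu : ∀ (ε : ℝ) (K : ℕ), (∀ k l, K ≤ k → K ≤ l →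
      ∀ M : Structure.{u, v} L, M.Models T → ∀ x : M.Assign Γ,
        |(P.seq k).eval M x - (P.seq l).eval M x| ≤ ε) → ∀ k l, K ≤ k → K ≤ l →
      ∀ (I : Type w) (U : Ultrafilter I) (M : I → Structure.{u, v} L), (∀ i, (M i).Models T) →
        ∀ x : (ultraproduct U M).Assign Γ,
          |(P.seq k).eval (ultraproduct U M) x - (P.seq l).eval (ultraproduct U M) x| ≤ ε := by
    intro ε K hK k l hk hl I U M hM x
    rw [← ultraTuple_ultraRep U M x]
    exact le_of_tendsto' (((P.seq k).tendsto_eval U M _).sub ((P.seq l).tendsto_eval U M _)).abs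
      fun i => hK k l hk hl (M i) (hM i) _
  refine ⟨P.seq K, fun M hM x => ?_, fun I U M hM x => ?_⟩
  · refine le_of_tendsto (tendsto_const_nhds.sub (P.tendsto_seq_eval M x fun ε hε => ?_)).abs ?_
    · obtain ⟨K, hK⟩ := P.cauchy ε hε
      exact ⟨K, fun k l hk hl => hK k l hk hl M hM x⟩
    · filter_upwards [eventually_ge_atTop K] with k hk using hK K k le_rfl hk M hM x
  · refine le_of_tendsto (tendsto_const_nhds.sub
      (P.tendsto_seq_eval (ultraproduct U M) x fun ε hε => ?_)).abs ?_
    · obtain ⟨K, hK⟩ := P.cauchy ε hε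
      exact ⟨K, fun k l hk hl => hu ε K hK k l hk hl I U M hM x⟩
    · filter_upwards [eventually_ge_atTop K] with k hk
        using hu ε K hK K k le_rfl hk I U M hM x

theorem DefinablePredicate.tendsto_eval {α : Type} {Γ : α → L.Sorts}
    (P : DefinablePredicate.{u, v} T Γ) {I : Type w} (U : Ultrafilter I)
    (M : I → Structure.{u, v} L) (hM : ∀ i, (M i).Models T) (a : ∀ i, (M i).Assign Γ) :
    Tendsto (fun i => P.eval (M i) (a i)) U
      (𝓝 (P.eval (ultraproduct U M) (ultraTuple U M a))) := by
  refine Metric.tendsto_nhds.2 fun ε hε => ?_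
  obtain ⟨φ, h₁, h₂⟩ := P.exists_formula (show 0 < ε / 3 by positivity)
  filter_upwards [Metric.tendsto_nhds.1 (φ.tendsto_eval U M a) (ε / 3) (by positivity)] with i hi
  have e₁ := abs_le.1 (h₁ (M i) (hM i) (a i))
  have e₂ := abs_le.1 (h₂ I U M hM (ultraTuple U M a))
  rw [Real.dist_eq, abs_lt] at hi ⊢
  constructor <;> linarith [e₁.1, e₁.2, e₂.1, e₂.2, hi.1, hi.2]

theorem DefinablePredicate.exists_modulus {α : Type} {Γ : α → L.Sorts}
    (P : DefinablePredicate.{u, v} T Γ) (M : Structure.{u, v} L) (hM : M.Models T) {ε : ℝ}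
    (hε : 0 < ε) : ∃ δ : ℝ, 0 < δ ∧ ∀ x y : M.Assign Γ, (∀ a, dist (x a) (y a) < δ) →
      |P.eval M x - P.eval M y| ≤ ε := by
  obtain ⟨φ, h₁, -⟩ := DefinablePredicate.exists_formula.{u, v, 0} P (show 0 < ε / 3 by positivity)
  obtain ⟨δ, hδ, h⟩ := φ.exists_modulus M (show 0 < ε / 3 by positivity)
  refine ⟨δ, hδ, fun x y hxy => ?_⟩
  have e₁ := abs_le.1 (h₁ M hM x)
  have e₂ := abs_le.1 (h₁ M hM y)
  have e₃ := abs_le.1 (h x y hxy)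
  rw [abs_le]
  constructor <;> linarith [e₁.1, e₁.2, e₂.1, e₂.2, e₃.1, e₃.2]

/-! ### The group in the ultraproduct -/

theorem tendsto_dist_ultraTuple {I : Type w} (U : Ultrafilter I) (M : I → Structure.{u, v} L)
    {n : ℕ} {Γ : Fin n → L.Sorts} (a b : ∀ i, (M i).Assign Γ) :
    Tendsto (fun i => dist (a i) (b i)) U
      (𝓝 (dist (ultraTuple U M a) (ultraTuple U M b))) := by
  simp only [dist_pi_def]
  refine NNReal.tendsto_coe.2 (Tendsto.finset_sup_nhds_apply fun k _ => ?_)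
  exact NNReal.tendsto_coe.1 (tendsto_dist_ultraMk U M (fun i => a i k) (fun i => b i k))

section UltraproductGroup

variable {G : GroupPredicates.{u, v} T} {I : Type w} (U : Ultrafilter I)
  {M : I → Structure.{u, v} L} (hM : ∀ i, (M i).Models T)

/-- The point of `G(∏_U M_i)` represented by a family of points of the `G(M_i)`. -/
noncomputable def GroupPredicates.ultraPoint (g : ∀ i, G.points (M i)) :
    G.points (ultraproduct U M) :=
  ⟨ultraTuple U M fun i => (g i : (M i).Assign G.Γ), by
    have h := G.D.tendsto_eval U M hM fun i => (g i : (M i).Assign G.Γ)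
    have h0 : (fun i => G.D.eval (M i) (g i : (M i).Assign G.Γ)) = fun _ => 0 :=
      funext fun i => (g i).2
    rw [h0] at h
    exact tendsto_nhds_unique h tendsto_const_nhds⟩

theorem GroupPredicates.tendsto_dist_ultraPoint (g h : ∀ i, G.points (M i)) :
    Tendsto (fun i => dist (g i) (h i)) U
      (𝓝 (dist (G.ultraPoint U hM g) (G.ultraPoint U hM h))) :=
  tendsto_dist_ultraTuple U M _ _

theorem GroupPredicates.ultraPoint_eq_iff (g h : ∀ i, G.points (M i)) :
    G.ultraPoint U hM g = G.ultraPoint U hM h ↔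
      Tendsto (fun i => dist (g i) (h i)) U (𝓝 0) := by
  have ht := G.tendsto_dist_ultraPoint U hM g h
  rw [← dist_eq_zero]
  exact ⟨fun h0 => h0 ▸ ht, fun h0 => tendsto_nhds_unique ht h0⟩

/-- Nearly nearest points of `G(M)`. -/
theorem GroupPredicates.GroupIn.exists_dist_le {N : Structure.{u, w} L} (H : G.GroupIn N)
    (x : N.Assign G.Γ) {ε : ℝ} (hε : 0 < ε) :
    ∃ g : G.points N, dist x g < G.D.eval N x + ε := by
  let _ := H.group
  obtain ⟨g, hg, hlt⟩ := (Metric.infDist_lt_iff ⟨_, (1 : G.points N).2⟩).1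
    (lt_add_of_pos_right (Metric.infDist x (G.points N)) hε)
  exact ⟨⟨g, hg⟩, by rw [H.dist_set x]; exact hlt⟩

theorem GroupPredicates.GroupIn.eval_D_nonneg {N : Structure.{u, w} L} (H : G.GroupIn N)
    (x : N.Assign G.Γ) : 0 ≤ G.D.eval N x := by
  rw [H.dist_set x]; exact Metric.infDist_nonneg

theorem GroupPredicates.GroupIn.eval_D_le {N : Structure.{u, w} L} (H : G.GroupIn N)
    (x : N.Assign G.Γ) (g : G.points N) : G.D.eval N x ≤ dist x g := by
  rw [H.dist_set x]; exact Metric.infDist_le_dist_of_mem g.2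

theorem GroupPredicates.ultraPoint_surjective (H : ∀ i, G.GroupIn (M i)) :
    Function.Surjective (G.ultraPoint U hM : (∀ i, G.points (M i)) → _) := by
  rintro ⟨x, hx⟩
  -- The distance to `G(M_i)` need not be attained. A factor `2` leaves room when it is positive;
  -- when it is zero, the representative already lies in `G(M_i)`.
  have hex : ∀ i, ∃ g : G.points (M i), dist (fun a => ultraRep U M (x a) i : (M i).Assign G.Γ) g ≤
      2 * G.D.eval (M i) fun a => ultraRep U M (x a) i := by
    intro i
    rcases ((H i).eval_D_nonneg fun a => ultraRep U M (x a) i).eq_or_lt with h0 | h0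
    · exact ⟨⟨_, h0.symm⟩, (dist_self _).trans_le (mul_nonneg zero_le_two h0.le)⟩
    · obtain ⟨g, hg⟩ := (H i).exists_dist_le _ h0
      exact ⟨g, by linarith⟩
  choose g hg using hex
  refine ⟨g, Subtype.ext ?_⟩
  have h1 := tendsto_dist_ultraTuple U M (fun i a => ultraRep U M (x a) i)
    (fun i => (g i : (M i).Assign G.Γ))
  have h2 := (G.D.tendsto_eval U M hM (fun i a => ultraRep U M (x a) i)).const_mul 2
  rw [ultraTuple_ultraRep, show G.D.eval (ultraproduct U M) x = 0 from hx, mul_zero] at h2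
  have h3 := tendsto_nhds_unique h1 (squeeze_zero (fun _ => dist_nonneg) hg h2)
  rw [ultraTuple_ultraRep] at h3
  exact (dist_eq_zero.1 h3).symm

variable (H : ∀ i, G.GroupIn (M i))

/-- Representatives in `G(M_i)` of a point of `G(∏_U M_i)`. -/
noncomputable def GroupPredicates.pointRep (x : G.points (ultraproduct U M)) (i : I) :
    G.points (M i) :=
  Function.surjInv (G.ultraPoint_surjective U hM H) x i

theorem GroupPredicates.ultraPoint_pointRep (x : G.points (ultraproduct U M)) :
    G.ultraPoint U hM (G.pointRep U hM H x) = x :=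
  Function.surjInv_eq (G.ultraPoint_surjective U hM H) x

/-- The product in `G(∏_U M_i)`. -/
noncomputable abbrev GroupPredicates.ultraMul : Mul (G.points (ultraproduct U M)) where
  mul x y := G.ultraPoint U hM fun i =>
    letI := (H i).group
    G.pointRep U hM H x i * G.pointRep U hM H y i

noncomputable abbrev GroupPredicates.ultraInv : Inv (G.points (ultraproduct U M)) where
  inv x := G.ultraPoint U hM fun i =>
    letI := (H i).group
    (G.pointRep U hM H x i)⁻¹

noncomputable abbrev GroupPredicates.ultraOne : One (G.points (ultraproduct U M)) where
  one := G.ultraPoint U hM fun i =>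
    letI := (H i).group
    1

/-- Łoś for `Q`. The limit depends only on the classes of `g`, `h` and `k`, which makes the product
independent of representatives. -/
theorem GroupPredicates.tendsto_dist_mul (g h k : ∀ i, G.points (M i)) :
    letI := fun i => (H i).group
    Tendsto (fun i => dist (g i * h i) (k i)) U (𝓝 (G.Q.eval (ultraproduct U M)
      ((ultraproduct U M).pair (G.ultraPoint U hM g : (ultraproduct U M).Assign G.Γ)
        ((ultraproduct U M).pair (G.ultraPoint U hM h : (ultraproduct U M).Assign G.Γ)
          (G.ultraPoint U hM k : (ultraproduct U M).Assign G.Γ))))) := by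
  have ht := G.Q.tendsto_eval U M hM fun i => (M i).pair (g i : (M i).Assign G.Γ)
    ((M i).pair (h i : (M i).Assign G.Γ) (k i : (M i).Assign G.Γ))
  rw [← pair_ultraTuple, ← pair_ultraTuple] at ht
  simp only [(H _).dist_mul] at ht
  exact ht

theorem GroupPredicates.ultraPoint_mul (g h : ∀ i, G.points (M i)) :
    letI := fun i => (H i).group
    letI := G.ultraMul U hM H
    G.ultraPoint U hM g * G.ultraPoint U hM h = G.ultraPoint U hM fun i => g i * h i := by
  let _ := fun i => (H i).group
  -- For `k i = g i * h i` the limit of `dist (g i * h i) (k i)` is `0`, and `dist (g' i * h' i) (k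
  -- i)` has the same limit.
  have key : ∀ g' h' : ∀ i, G.points (M i), G.ultraPoint U hM g' = G.ultraPoint U hM g →
      G.ultraPoint U hM h' = G.ultraPoint U hM h →
      G.ultraPoint U hM (fun i => g' i * h' i) = G.ultraPoint U hM fun i => g i * h i := by
    intro g' h' hg hh
    have h1 := G.tendsto_dist_mul U hM H g h fun i => g i * h i
    have h2 := G.tendsto_dist_mul U hM H g' h' fun i => g i * h i
    simp only [dist_self] at h1
    rw [hg, hh, tendsto_nhds_unique h1 tendsto_const_nhds] at h2
    exact (G.ultraPoint_eq_iff U hM _ _).2 h2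
  exact key _ _ (G.ultraPoint_pointRep U hM H _) (G.ultraPoint_pointRep U hM H _)

/-- The group structure of `G(∏_U M_i)`. -/
noncomputable abbrev GroupPredicates.ultraGroup : Group (G.points (ultraproduct U M)) :=
  letI := fun i => (H i).group
  letI := G.ultraMul U hM H
  letI := G.ultraInv U hM H
  letI := G.ultraOne U hM H
  Group.ofLeftAxioms
    (fun x y z => by
      obtain ⟨x, rfl⟩ := G.ultraPoint_surjective U hM H x
      obtain ⟨y, rfl⟩ := G.ultraPoint_surjective U hM H y
      obtain ⟨z, rfl⟩ := G.ultraPoint_surjective U hM H z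
      simp only [G.ultraPoint_mul U hM H, mul_assoc])
    (fun x => by
      obtain ⟨x, rfl⟩ := G.ultraPoint_surjective U hM H x
      refine (G.ultraPoint_mul U hM H _ _).trans ?_
      simp only [one_mul])
    (fun x => by
      -- The inverse is defined through `pointRep`, so `x` is written with the same representatives
      -- to cancel in each factor.
      conv_lhs => rw [← G.ultraPoint_pointRep U hM H x]
      refine (G.ultraPoint_mul U hM H _ _).trans ?_
      simp only [G.ultraPoint_pointRep U hM H x, inv_mul_cancel]
      rfl)

/-- `G` is a definable group in the ultraproduct. -/
noncomputable def GroupPredicates.GroupIn.ultraproduct :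
    G.GroupIn (MetricLanguage.ultraproduct U M) where
  group := G.ultraGroup U hM H
  dist_set x := by
    let _ := fun i => (H i).group
    have hne : (G.points (MetricLanguage.ultraproduct U M)).Nonempty :=
      ⟨_, (G.ultraPoint U hM fun i => (1 : G.points (M i))).2⟩
    obtain ⟨a, rfl⟩ : ∃ a, ultraTuple U M a = x := ⟨_, ultraTuple_ultraRep U M x⟩
    have hD := G.D.tendsto_eval U M hM a
    apply le_antisymm
    · refine (Metric.le_infDist hne).2 fun y hy => ?_
      obtain ⟨g, hg⟩ := G.ultraPoint_surjective U hM H ⟨y, hy⟩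
      have hy' : y = ultraTuple U M fun i => (g i : (M i).Assign G.Γ) :=
        (congrArg Subtype.val hg).symm
      rw [hy']
      exact le_of_tendsto_of_tendsto' hD (tendsto_dist_ultraTuple U M a _)
        fun i => (H i).eval_D_le _ _
    -- Points of `G(M_i)` within `ε` of optimal define a point of the ultraproduct within `ε` of
    -- optimal.
    · refine le_of_forall_pos_le_add fun ε hε => ?_
      choose g hg using fun i => (H i).exists_dist_le (a i) hε
      refine (Metric.infDist_le_dist_of_mem (G.ultraPoint U hM g).2).trans ?_
      exact le_of_tendsto_of_tendsto' (tendsto_dist_ultraTuple U M a _) (hD.add_const ε)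
        fun i => (hg i).le
  dist_mul x y z := by
    obtain ⟨x, rfl⟩ := G.ultraPoint_surjective U hM H x
    obtain ⟨y, rfl⟩ := G.ultraPoint_surjective U hM H y
    obtain ⟨z, rfl⟩ := G.ultraPoint_surjective U hM H z
    refine tendsto_nhds_unique (G.tendsto_dist_mul U hM H x y z) ?_
    refine (G.tendsto_dist_ultraPoint U hM _ z).trans_eq ?_
    exact congrArg (fun p => 𝓝 (dist p (G.ultraPoint U hM z))) (G.ultraPoint_mul U hM H x y).symm

/-- Compatibility of products with classes suffices: multiply by the class of `g` and cancel. -/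
theorem GroupPredicates.ultraPoint_inv_mul (g h : ∀ i, G.points (M i)) :
    letI := fun i => (H i).group
    letI := (GroupIn.ultraproduct U hM H).group
    (G.ultraPoint U hM g)⁻¹ * G.ultraPoint U hM h =
      G.ultraPoint U hM fun i => (g i)⁻¹ * h i := by
  let _ := fun i => (H i).group
  let _ := (GroupIn.ultraproduct U hM H).group
  refine inv_mul_eq_of_eq_mul ?_
  refine Eq.trans ?_ (G.ultraPoint_mul U hM H _ _).symm
  simp only [mul_inv_cancel_left]

end UltraproductGroup

/-! ### Functions given by formulas with parameters -/

/-- The functions given by formulas with parameters in `M`. -/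
def Structure.formulaFunctions (M : Structure.{u, v} L) {α : Type} (Γ : α → L.Sorts) :
    Set (M.Assign Γ → ℝ) := Set.range (ParamFormula.eval (M := M) (Γ := Γ))

theorem Structure.eval_subst_mem_formulaFunctions (M : Structure.{u, v} L) {α α' β : Type}
    {Γ : α → L.Sorts} {Γ' : α' → L.Sorts} {Δ : β → L.Sorts} (θ : Formula L Γ')
    (σ : ∀ a, Term L (Sum.elim Γ Δ) (Γ' a)) (d : M.Assign Δ) :
    (fun x : M.Assign Γ => θ.eval M fun a => (σ a).eval M (M.pair x d)) ∈
      M.formulaFunctions Γ :=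
  ⟨⟨θ.subst σ, d⟩, funext fun _ => Formula.eval_subst M θ σ _⟩

theorem Structure.conn_mem_formulaFunctions (M : Structure.{u, v} L) {α : Type}
    {Γ : α → L.Sorts} {n : ℕ} (c : (Fin n → ℝ) → ℝ) (hc : UniformContinuous c)
    (f : Fin n → M.Assign Γ → ℝ) (hf : ∀ k, f k ∈ M.formulaFunctions Γ) :
    (fun x => c fun k => f k x) ∈ M.formulaFunctions Γ := by
  choose φ hφ using hf
  -- The parameter tuples of the `φ k` are juxtaposed over a disjoint union of contexts.
  let Δ : (Σ k, (φ k).β) → L.Sorts := fun p => (φ p.1).Δ p.2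
  let σ : ∀ k a, Term L (Sum.elim Γ Δ) (Sum.elim Γ (φ k).Δ a) := fun k a => match a with
    | .inl a => .var (Γ := Sum.elim Γ Δ) (.inl a)
    | .inr b => .var (Γ := Sum.elim Γ Δ) (.inr ⟨k, b⟩)
  refine ⟨⟨.conn c hc fun k => (φ k).form.subst (σ k), (fun p => (φ p.1).par p.2 : M.Assign Δ)⟩,
    funext fun x => ?_⟩
  simp only [ParamFormula.eval, Formula.eval, Formula.eval_subst, ← hφ]
  congr 1
  funext k
  congr 1
  funext a
  rcases a with a | b <;> rfl

theorem Structure.exists_inf_mem_formulaFunctions (M : Structure.{u, v} L) {α : Type} {n : ℕ}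
    {Γ : Fin n → L.Sorts} {Γ' : α → L.Sorts} (f : M.Assign (Sum.elim Γ Γ') → ℝ)
    (hf : f ∈ M.formulaFunctions (Sum.elim Γ Γ')) : ∃ h ∈ M.formulaFunctions Γ',
      ∀ x, IsGLB (Set.range fun y => f (M.pair y x)) (h x) := by
  obtain ⟨φ, rfl⟩ := hf
  let σ : ∀ a, Term L (Sum.elim Γ (Sum.elim Γ' φ.Δ)) (Sum.elim (Sum.elim Γ Γ') φ.Δ a)
    | .inl (.inl a) => .var (Γ := Sum.elim Γ (Sum.elim Γ' φ.Δ)) (.inl a)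
    | .inl (.inr a) => .var (Γ := Sum.elim Γ (Sum.elim Γ' φ.Δ)) (.inr (.inl a))
    | .inr b => .var (Γ := Sum.elim Γ (Sum.elim Γ' φ.Δ)) (.inr (.inr b))
  obtain ⟨ψ, hψ⟩ := Formula.exists_infTuple.{u, v} (φ.form.subst σ)
  refine ⟨_, ⟨⟨ψ, φ.par⟩, rfl⟩, fun x => ?_⟩
  have h := hψ M (M.pair x φ.par)
  simp only [Formula.eval_subst] at h
  refine (congrArg (fun k => IsGLB (Set.range k) _) (funext fun y => ?_)).mp h
  refine congrArg (φ.form.eval M) (funext fun a => ?_)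
  rcases a with (a | a) | b <;> rfl

theorem dist_pair_lt (M : Structure.{u, v} L) {α β : Type} {Γ : α → L.Sorts}
    {Δ : β → L.Sorts} {x x' : M.Assign Γ} {y y' : M.Assign Δ} {δ : ℝ}
    (hx : ∀ a, dist (x a) (x' a) < δ) (hy : ∀ b, dist (y b) (y' b) < δ) :
    ∀ o, dist (M.pair x y o) (M.pair x' y' o) < δ
  | .inl a => hx a
  | .inr b => hy b

theorem ParamFormula.exists_modulus {M : Structure.{u, v} L} {α : Type} {Γ : α → L.Sorts}
    (φ : ParamFormula M Γ) {ε : ℝ} (hε : 0 < ε) : ∃ δ : ℝ, 0 < δ ∧ ∀ x y : M.Assign Γ,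
      (∀ a, dist (x a) (y a) < δ) → |φ.eval x - φ.eval y| ≤ ε := by
  obtain ⟨δ, hδ, h⟩ := φ.form.exists_modulus M hε
  exact ⟨δ, hδ, fun x y hxy => h _ _ (dist_pair_lt M hxy fun b => (dist_self _).trans_lt hδ)⟩

/-! ### Translates of predicates -/

section Translate

variable {G : GroupPredicates.{u, v} T} {M : Structure.{u, v} L}

/-- Points which nearly satisfy the definition of `g⁻¹ x` are near `g⁻¹ x`. -/
theorem GroupPredicates.GroupIn.exists_translate_modulus (H : G.GroupIn M) (hM : M.Models T)
    (g : G.points M) (φ : ParamFormula M G.Γ) {ε : ℝ} (hε : 0 < ε) :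
    letI := H.group
    ∃ δ : ℝ, 0 < δ ∧ ∀ (x : G.points M) (y : M.Assign G.Γ), G.D.eval M y < δ →
      G.Q.eval M (M.pair (g : M.Assign G.Γ) (M.pair y (x : M.Assign G.Γ))) < δ →
      |φ.eval y - φ.eval ((g⁻¹ * x : G.points M) : M.Assign G.Γ)| ≤ ε := by
  let _ := H.group
  obtain ⟨δ₁, hδ₁, h₁⟩ := φ.exists_modulus hε
  obtain ⟨δ₂, hδ₂, h₂⟩ := G.Q.exists_modulus M hM (show 0 < δ₁ / 3 by positivity)
  obtain ⟨δ₃, hδ₃, h₃⟩ := G.Q.exists_modulus M hM (show 0 < δ₂ / 3 by positivity)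
  -- Left translation by `g⁻¹` is uniformly continuous: `d(g⁻¹ h, g⁻¹ h')` is `Q(g⁻¹, h, g⁻¹ h')`,
  -- and `Q` vanishes if `h` is replaced by `h'`.
  have hmul : ∀ h h' : G.points M, dist h h' < δ₂ → dist (g⁻¹ * h) (g⁻¹ * h') ≤ δ₁ / 3 := by
    intro h h' hh
    have := h₂ (M.pair (g⁻¹ : G.points M).1 (M.pair h.1 (g⁻¹ * h').1))
      (M.pair (g⁻¹ : G.points M).1 (M.pair h'.1 (g⁻¹ * h').1))
      (dist_pair_lt M (fun a => (dist_self _).trans_lt hδ₂)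
        (dist_pair_lt M (fun a => (dist_le_pi_dist h.1 h'.1 a).trans_lt hh)
          fun a => (dist_self _).trans_lt hδ₂))
    rw [H.dist_mul, H.dist_mul, dist_self, sub_zero] at this
    exact (abs_le.1 this).2
  -- Let `y'` be a point of `G(M)` within `δ` of `y`. The bound `δ₃ / 2` allows `y` to be replaced
  -- by `y'` in `Q`; `δ₂ / 3` gives `d(g y', x) < δ₂`, hence `d(y', g⁻¹ x) ≤ δ₁ / 3`; and `δ₁ / 3`
  -- bounds `d(y, y')`.
  refine ⟨min (min (δ₃ / 2) (δ₂ / 3)) (δ₁ / 3), by positivity, fun x y hy hxy => ?_⟩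
  have hm₁ := min_le_right (min (δ₃ / 2) (δ₂ / 3)) (δ₁ / 3)
  have hm₂ := (min_le_left (min (δ₃ / 2) (δ₂ / 3)) (δ₁ / 3)).trans (min_le_right _ _)
  have hm₃ := (min_le_left (min (δ₃ / 2) (δ₂ / 3)) (δ₁ / 3)).trans (min_le_left _ _)
  set δ := min (min (δ₃ / 2) (δ₂ / 3)) (δ₁ / 3)
  obtain ⟨y', hy'⟩ := H.exists_dist_le y (sub_pos.2 hy)
  rw [add_sub_cancel] at hy'
  have e₁ := h₃ (M.pair g.1 (M.pair y x.1)) (M.pair g.1 (M.pair y'.1 x.1))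
    (dist_pair_lt M (fun a => (dist_self _).trans_lt hδ₃)
      (dist_pair_lt M (fun a => (dist_le_pi_dist y y'.1 a).trans_lt (by linarith))
        fun a => (dist_self _).trans_lt hδ₃))
  rw [H.dist_mul] at e₁
  have e₂ := hmul (g * y') x (by linarith [(abs_le.1 e₁).1])
  rw [inv_mul_cancel_left] at e₂
  have e₃ : dist y (g⁻¹ * x).1 < δ₁ := by
    have := dist_triangle y y'.1 (g⁻¹ * x).1
    have e₂' : dist y'.1 (g⁻¹ * x).1 ≤ δ₁ / 3 := e₂
    linarith
  exact h₁ _ _ fun a => (dist_le_pi_dist _ _ a).trans_lt e₃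

theorem uniformContinuous_penalty (K η : ℝ) : UniformContinuous fun r : Fin 3 → ℝ =>
    r 0 + K * max (r 1 - η) 0 + K * max (r 2 - η) 0 := by
  have h : ∀ k : Fin 3, UniformContinuous fun r : Fin 3 → ℝ => max (r k - η) 0 := fun k =>
    (LipschitzWith.id.max_const 0).uniformContinuous.comp
      ((Pi.uniformContinuous_proj _ k).sub uniformContinuous_const)
  exact ((Pi.uniformContinuous_proj _ 0).add ((h 1).const_smul K)).add ((h 2).const_smul K)

theorem ParamFormula.exists_bound {α : Type} {Γ : α → L.Sorts} (φ : ParamFormula M Γ) :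
    ∃ B : ℝ, ∀ x, |φ.eval x| ≤ B := by
  obtain ⟨B, hB⟩ := φ.form.exists_bound
  exact ⟨B, fun x => hB M _⟩

/-- Translates of formulas are approximated uniformly on `G(M)` by formulas. -/
theorem GroupPredicates.GroupIn.exists_formula_translate (H : G.GroupIn M) (hM : M.Models T)
    (g : G.points M) (φ : ParamFormula M G.Γ) {ε : ℝ} (hε : 0 < ε) :
    letI := H.group
    ∃ ψ : ParamFormula M G.Γ, ∀ x : G.points M,
      |φ.eval ((g⁻¹ * x : G.points M) : M.Assign G.Γ) - ψ.eval x| ≤ ε := by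
  let _ := H.group
  obtain ⟨δ, hδ, hmod⟩ := H.exists_translate_modulus hM g φ hε
  obtain ⟨B, hB⟩ := φ.exists_bound
  have hB0 : 0 ≤ B := (abs_nonneg _).trans (hB (1 : G.points M))
  obtain ⟨D', hD', -⟩ :=
    DefinablePredicate.exists_formula.{u, v, 0} G.D (show 0 < δ / 4 by positivity)
  obtain ⟨Q', hQ', -⟩ :=
    DefinablePredicate.exists_formula.{u, v, 0} G.Q (show 0 < δ / 4 by positivity)
  have h0 : (fun z : M.Assign (Sum.elim G.Γ G.Γ) => φ.eval fun a => z (.inl a)) ∈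
      M.formulaFunctions (Sum.elim G.Γ G.Γ) := by
    refine (congrArg (· ∈ M.formulaFunctions _) (funext fun z => ?_)).mp
      (M.eval_subst_mem_formulaFunctions φ.form
        (fun
          | .inl a => .var (Γ := Sum.elim (Sum.elim G.Γ G.Γ) φ.Δ) (.inl (.inl a))
          | .inr b => .var (Γ := Sum.elim (Sum.elim G.Γ G.Γ) φ.Δ) (.inr b)) φ.par)
    refine congrArg (φ.form.eval M) (funext fun a => ?_)
    rcases a with a | b <;> rfl
  have h1 : (fun z : M.Assign (Sum.elim G.Γ G.Γ) => D'.eval M fun a => z (.inl a)) ∈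
      M.formulaFunctions (Sum.elim G.Γ G.Γ) :=
    M.eval_subst_mem_formulaFunctions D'
      (fun a => .var (Γ := Sum.elim (Sum.elim G.Γ G.Γ) G.Γ) (.inl (.inl a))) g.1
  have h2 : (fun z : M.Assign (Sum.elim G.Γ G.Γ) => Q'.eval M (M.pair g.1 z)) ∈
      M.formulaFunctions (Sum.elim G.Γ G.Γ) := by
    refine (congrArg (· ∈ M.formulaFunctions _) (funext fun z => ?_)).mp
      (M.eval_subst_mem_formulaFunctions Q'
        (fun
          | .inl a => .var (Γ := Sum.elim (Sum.elim G.Γ G.Γ) G.Γ) (.inr a)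
          | .inr b => .var (Γ := Sum.elim (Sum.elim G.Γ G.Γ) G.Γ) (.inl b)) g.1)
    refine congrArg (Q'.eval M) (funext fun a => ?_)
    rcases a with a | b <;> rfl
  -- `ψ(x)` is the infimum over `y` of `φ(y) + K (D'(y) - δ/4)⁺ + K (Q'(g, y, x) - δ/4)⁺` with `K =
  -- 4B/δ`. The threshold `δ/4` absorbs the error of `D'` and `Q'`.
  obtain ⟨_, ⟨ψ, rfl⟩, hψ⟩ := M.exists_inf_mem_formulaFunctions _
    (M.conn_mem_formulaFunctions _ (uniformContinuous_penalty (4 * B / δ) (δ / 4)) ![_, _, _]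
      (Fin.forall_fin_succ.2 ⟨h0, Fin.forall_fin_two.2 ⟨h1, h2⟩⟩))
  simp only [Matrix.cons_val] at hψ
  refine ⟨ψ, fun x => ?_⟩
  set z : G.points M := g⁻¹ * x with hz
  have hK : 0 ≤ 4 * B / δ := by positivity
  have hKδ : 4 * B / δ * (δ / 2) = 2 * B := by field_simp; ring
  -- The point `y = g⁻¹ x` pays no penalty.
  have hup : ψ.eval x ≤ φ.eval z := by
    refine ((hψ x).1 ⟨z, rfl⟩).trans ?_
    have e₁ := (abs_le.1 (hD' M hM z)).2
    have e₂ := (abs_le.1 (hQ' M hM (M.pair g.1 (M.pair z.1 x.1)))).2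
    rw [show G.D.eval M z = 0 from z.2, sub_zero] at e₁
    rw [H.dist_mul, hz, mul_inv_cancel_left, dist_self, sub_zero, ← hz] at e₂
    have e₁' : max (D'.eval M z - δ / 4) 0 = 0 := max_eq_right (by linarith)
    have e₂' : max (Q'.eval M (M.pair g.1 (M.pair z.1 x.1)) - δ / 4) 0 = 0 :=
      max_eq_right (by linarith)
    refine le_of_eq (Eq.trans (congrArg₂ (· + ·) (congrArg₂ (· + ·) rfl
      (congrArg (4 * B / δ * ·) e₁')) (congrArg (4 * B / δ * ·) e₂')) ?_)
    simp only [mul_zero, add_zero]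
    rfl
  -- If `D(y)` and `Q(g, y, x)` are below `δ`, then `φ(y)` is close to `φ(z)`. Otherwise some
  -- penalty is at least `K · δ/2 = 2B`, the largest possible gap between values of `φ`.
  have hlow : φ.eval z - ε ≤ ψ.eval x := by
    refine (hψ x).2 ?_
    rintro _ ⟨y, rfl⟩
    change _ ≤ φ.eval y + 4 * B / δ * max (D'.eval M y - δ / 4) 0 +
      4 * B / δ * max (Q'.eval M (M.pair g.1 (M.pair y x.1)) - δ / 4) 0
    have n₁ := mul_nonneg hK (le_max_right (D'.eval M y - δ / 4) 0)
    have n₂ := mul_nonneg hK (le_max_right (Q'.eval M (M.pair g.1 (M.pair y x.1)) - δ / 4) 0)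
    have b₁ := (abs_le.1 (hB z)).2
    have b₂ := (abs_le.1 (hB y)).1
    by_cases hDy : G.D.eval M y < δ
    · by_cases hQy : G.Q.eval M (M.pair g.1 (M.pair y x.1)) < δ
      · have := (abs_le.1 (hmod x y hDy hQy)).1
        linarith
      · have e := (abs_le.1 (hQ' M hM (M.pair g.1 (M.pair y x.1)))).1
        have := mul_le_mul_of_nonneg_left ((show δ / 2 ≤
          Q'.eval M (M.pair g.1 (M.pair y x.1)) - δ / 4 by linarith).trans (le_max_left _ 0)) hK
        linarith
    · have e := (abs_le.1 (hD' M hM y)).1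
      have := mul_le_mul_of_nonneg_left ((show δ / 2 ≤
        D'.eval M y - δ / 4 by linarith).trans (le_max_left _ 0)) hK
      linarith
  exact abs_le.2 ⟨by linarith, by linarith⟩

end Translate

/-! ### Uniform limits on a set -/

/-- The value `a` moved into the interval of radius `r` about `b`. -/
def forceNear (r b a : ℝ) : ℝ := b + max (-r) (min r (a - b))

theorem abs_forceNear_sub_le {r : ℝ} (hr : 0 ≤ r) (b a : ℝ) : |forceNear r b a - b| ≤ r := by
  rw [forceNear, add_sub_cancel_left, abs_le]
  exact ⟨le_max_left _ _, max_le (by linarith) (min_le_left _ _)⟩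

theorem forceNear_of_abs_le {r b a : ℝ} (h : |a - b| ≤ r) : forceNear r b a = a := by
  obtain ⟨h1, h2⟩ := abs_le.1 h
  rw [forceNear, min_eq_right h2, max_eq_right h1, add_sub_cancel]

theorem uniformContinuous_forceNear (r : ℝ) :
    UniformContinuous fun p : Fin 2 → ℝ => forceNear r (p 0) (p 1) := by
  have h : UniformContinuous fun t : ℝ => max (-r) (min r t) :=
    ((LipschitzWith.id.const_min r).const_max (-r)).uniformContinuous
  exact (Pi.uniformContinuous_proj _ 0).add
    (h.comp ((Pi.uniformContinuous_proj _ 1).sub (Pi.uniformContinuous_proj _ 0)))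

/-- A uniform limit of formulas on a set `S` extends to a definable predicate. -/
theorem Structure.exists_mem_predicates_eqOn (M : Structure.{u, v} L) {α : Type}
    {Γ : α → L.Sorts} {S : Set (M.Assign Γ)} (f : S → ℝ)
    (h : ∀ ε : ℝ, 0 < ε → ∃ φ : ParamFormula M Γ, ∀ x : S, |f x - φ.eval x| ≤ ε) :
    ∃ P ∈ M.predicates Γ, ∀ x : S, P x = f x := by
  choose φ hφ using fun n : ℕ => h ((1 / 2) ^ n) (by positivity)
  -- Truncating each approximation around the previous one makes the sequence uniformly Cauchy on
  -- all of `M`. On `S` nothing changes: consecutive `φ n` differ there by at most `3/2 · (1/2)^n`.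
  let F : ℕ → M.formulaFunctions Γ := fun n => Nat.rec ⟨_, φ 0, rfl⟩
    (fun n f => ⟨fun x => forceNear (2 * (1 / 2) ^ n) (f.1 x) ((φ (n + 1)).eval x),
      M.conn_mem_formulaFunctions _ (uniformContinuous_forceNear _) ![f.1, (φ (n + 1)).eval]
        (Fin.forall_fin_two.2 ⟨f.2, ⟨_, rfl⟩⟩)⟩) n
  have hS : ∀ n, ∀ x : S, (F n).1 x = (φ n).eval x := by
    intro n
    induction n with
    | zero => exact fun x => rfl
    | succ n ih =>
      intro x
      refine forceNear_of_abs_le ?_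
      rw [ih x]
      have e₁ := abs_le.1 (hφ n x)
      have e₂ := abs_le.1 (hφ (n + 1) x)
      rw [pow_succ] at e₂
      have : (0 : ℝ) < (1 / 2) ^ n := by positivity
      exact abs_le.2 ⟨by linarith, by linarith⟩
  have hd : ∀ x n, dist ((F n).1 x) ((F (n + 1)).1 x) ≤ 2 * (1 / 2) ^ n := by
    intro x n
    rw [dist_comm, Real.dist_eq]
    exact abs_forceNear_sub_le (by positivity) _ _
  choose P hP using fun x =>
    cauchySeq_tendsto_of_complete (cauchySeq_of_le_geometric (1 / 2) 2 (by norm_num) (hd x))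
  -- `4 · (1/2)^n` is the tail sum from `n` of the steps `2 · (1/2)^k`.
  have h0 : Tendsto (fun n : ℕ => (4 : ℝ) * (1 / 2) ^ n) atTop (𝓝 0) := by
    simpa using (tendsto_pow_atTop_nhds_zero_of_lt_one (r := (1 / 2 : ℝ)) (by norm_num)
      (by norm_num)).const_mul 4
  refine ⟨P, fun ε hε => ?_, fun x => ?_⟩
  · obtain ⟨n, hn⟩ := (h0.eventually_lt_const hε).exists
    obtain ⟨ψ, hψ⟩ := (F n).2
    refine ⟨ψ, fun x => ?_⟩
    have := dist_le_of_le_geometric_of_tendsto (1 / 2) 2 (by norm_num) (hd x) (hP x) n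
    rw [dist_comm, Real.dist_eq] at this
    rw [hψ]
    refine this.trans (le_trans (le_of_eq ?_) hn.le)
    ring
  · refine tendsto_nhds_unique (hP x) ?_
    simp only [hS]
    have h1 : Tendsto (fun n : ℕ => (1 / 2 : ℝ) ^ n) atTop (𝓝 0) :=
      tendsto_pow_atTop_nhds_zero_of_lt_one (by norm_num) (by norm_num)
    refine tendsto_iff_dist_tendsto_zero.2 (squeeze_zero (fun _ => dist_nonneg) (fun n => ?_) h1)
    rw [dist_comm, Real.dist_eq]
    exact hφ n x

/-- Translates of definable predicates on `G(M)` are definable predicates on `G(M)`. -/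
theorem GroupPredicates.GroupIn.translate_mem_predicatesOn {G : GroupPredicates.{u, v} T}
    {M : Structure.{u, v} L} (H : G.GroupIn M) (hM : M.Models T) (g : G.points M)
    (P : G.predicatesOn M) :
    letI := H.group
    (fun x => (P : G.points M → ℝ) (g⁻¹ * x)) ∈ G.predicatesOn M := by
  let _ := H.group
  obtain ⟨_, P, hP, rfl⟩ := P
  -- The formulas approximate the translate on `G(M)` only, whereas membership requires a predicate
  -- on all of `M`.
  obtain ⟨P', hP', h⟩ := M.exists_mem_predicates_eqOn
    (fun x : G.points M => P (g⁻¹ * x : G.points M)) fun ε hε => by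
      obtain ⟨φ, hφ⟩ := hP (ε / 2) (half_pos hε)
      obtain ⟨ψ, hψ⟩ := H.exists_formula_translate hM g φ (half_pos hε)
      refine ⟨ψ, fun x => ?_⟩
      have e₁ := abs_le.1 (hφ (g⁻¹ * x : G.points M))
      have e₂ := abs_le.1 (hψ x)
      exact abs_le.2 ⟨by linarith, by linarith⟩
  exact ⟨P', hP', funext h⟩

/-! ### Means -/

section Mean

variable {G : GroupPredicates.{u, v} T} {N : Structure.{u, w} L}

theorem GroupPredicates.Mean.ext' {m m' : G.Mean N} (h : ∀ f, m.toFun f = m'.toFun f) :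
    m = m' := by
  cases m
  cases m'
  congr
  exact LinearMap.ext h

theorem GroupPredicates.Mean.le_of_forall_le (m : G.Mean N) (f : G.predicatesOn N) {c : ℝ}
    (h : ∀ x, c ≤ (f : G.points N → ℝ) x) : c ≤ m.toFun f := by
  have := m.nonneg (f - c • G.res N ⟨1, N.one_mem_predicates G.Γ⟩) fun x => by
    have h1 : ((f - c • G.res N ⟨1, N.one_mem_predicates G.Γ⟩ : G.predicatesOn N) :
      G.points N → ℝ) x = (f : G.points N → ℝ) x - c * 1 := rfl
    rw [h1, mul_one]
    exact sub_nonneg.2 (h x)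
  rw [map_sub, map_smul, m.map_one, smul_eq_mul, mul_one] at this
  exact sub_nonneg.1 this

theorem GroupPredicates.Mean.abs_sub_le (m : G.Mean N) (f g : G.predicatesOn N) {c : ℝ}
    (h : ∀ x, |(f : G.points N → ℝ) x - (g : G.points N → ℝ) x| ≤ c) :
    |m.toFun f - m.toFun g| ≤ c := by
  have h1 := m.le_of_forall_le (f - g) fun x => (abs_le.1 (h x)).1
  have h2 := m.le_of_forall_le (g - f) (c := -c) fun x => by
    have : ((g - f : G.predicatesOn N) : G.points N → ℝ) x =
      (g : G.points N → ℝ) x - (f : G.points N → ℝ) x := rfl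
    rw [this]
    linarith [(abs_le.1 (h x)).2]
  rw [map_sub] at h1 h2
  exact abs_le.2 ⟨h1, by linarith⟩

theorem GroupPredicates.Mean.abs_le (m : G.Mean N) (f : G.predicatesOn N) {c : ℝ}
    (h : ∀ x, |(f : G.points N → ℝ) x| ≤ c) : |m.toFun f| ≤ c := by
  have := m.abs_sub_le f 0 (c := c) fun x => by simpa using h x
  simpa using this

end Mean

/-- Apply the hypothesis to a family that picks a counterexample at every index where one exists.
This turns approximation along families of points into uniform approximation. -/
theorem eventually_forall_of_forall_eventually {I : Type*} {l : Filter I} {X : I → Type*}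
    [∀ i, Nonempty (X i)] {p : ∀ i, X i → Prop}
    (h : ∀ x : ∀ i, X i, ∀ᶠ i in l, p i (x i)) : ∀ᶠ i in l, ∀ x, p i x := by
  classical
  have hx : ∀ i, ∃ x, p i x → ∀ y, p i y := fun i => by
    by_cases hi : ∀ y, p i y
    · exact ⟨Classical.arbitrary _, fun _ => hi⟩
    · obtain ⟨y, hy⟩ := not_forall.1 hi
      exact ⟨y, fun h => absurd h hy⟩
  choose x hx using hx
  exact (h x).mono hx

/-! ### Ultralimits of means -/

section UltraMean

variable {G : GroupPredicates.{u, v} T} {I : Type w} (U : Ultrafilter I)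
  {M : I → Structure.{u, v} L} (hM : ∀ i, (M i).Models T)

/-- The family `p` approximates `f` along the ultrafilter, up to `ε`. -/
def GroupPredicates.UltraApprox (ε : ℝ) (f : G.points (ultraproduct U M) → ℝ)
    (p : ∀ i, G.predicatesOn (M i)) : Prop :=
  ∀ x : ∀ i, G.points (M i),
    ∀ᶠ i in (U : Filter I), |f (G.ultraPoint U hM x) - (p i : G.points (M i) → ℝ) (x i)| ≤ ε

/-- `r` is the value at `f` of the ultralimit of the means `m i`. -/
def GroupPredicates.HasUltraMean (m : ∀ i, G.Mean (M i))
    (f : G.points (ultraproduct U M) → ℝ) (r : ℝ) : Prop :=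
  ∀ ε : ℝ, 0 < ε → ∃ p : ∀ i, G.predicatesOn (M i), G.UltraApprox U hM ε f p ∧
    ∀ᶠ i in (U : Filter I), |(m i).toFun (p i) - r| ≤ ε

theorem GroupPredicates.ultraApprox_formulaOn {β : Type} {Δ : β → L.Sorts}
    (φ : Formula L (Sum.elim G.Γ Δ)) (a : ∀ i, (M i).Assign Δ) {ε : ℝ} (hε : 0 < ε) :
    G.UltraApprox U hM ε (G.formulaOn (ultraproduct U M) φ (ultraTuple U M a))
      fun i => G.formulaOn (M i) φ (a i) := by
  intro x
  have h := φ.tendsto_eval U M fun i => (M i).pair (x i).1 (a i)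
  rw [← pair_ultraTuple] at h
  filter_upwards [Metric.tendsto_nhds.1 h ε hε] with i hi
  rw [dist_comm, Real.dist_eq] at hi
  exact hi.le

theorem GroupPredicates.UltraApprox.mono {ε η : ℝ} {f g : G.points (ultraproduct U M) → ℝ}
    {p : ∀ i, G.predicatesOn (M i)} (h : G.UltraApprox U hM ε f p)
    (hfg : ∀ x, |g x - f x| ≤ η) : G.UltraApprox U hM (η + ε) g p := fun x => by
  filter_upwards [h x] with i hi
  exact (abs_sub_le _ (f (G.ultraPoint U hM x)) _).trans (add_le_add (hfg _) hi)

/-- Elements of `predicatesOn` are approximated by formulas. -/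
theorem GroupPredicates.exists_formulaOn {N : Structure.{u, w} L} (f : G.predicatesOn N) {ε : ℝ}
    (hε : 0 < ε) : ∃ φ : ParamFormula N G.Γ, ∀ x : G.points N,
      |(f : G.points N → ℝ) x - φ.eval x| ≤ ε := by
  obtain ⟨_, P, hP, rfl⟩ := f
  obtain ⟨φ, hφ⟩ := hP ε hε
  exact ⟨φ, fun x => hφ x⟩

/-- A formula near `f`, with its parameters lifted to representatives, gives the family; its uniform
bound makes the means converge along `U`. -/
theorem GroupPredicates.exists_ultraApprox (m : ∀ i, G.Mean (M i))
    (f : G.predicatesOn (ultraproduct U M)) {ε : ℝ} (hε : 0 < ε) :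
    ∃ (p : ∀ i, G.predicatesOn (M i)) (s : ℝ), G.UltraApprox U hM ε f p ∧
      Tendsto (fun i => (m i).toFun (p i)) U (𝓝 s) := by
  obtain ⟨φ, hφ⟩ := G.exists_formulaOn f (half_pos hε)
  obtain ⟨B, hB⟩ := φ.form.exists_bound
  refine ⟨fun i => G.formulaOn (M i) φ.form fun b => ultraRep U M (φ.par b) i, _, ?_,
    tendsto_ulim U (a := -B) (b := B) fun i => abs_le.1 ((m i).abs_le _ fun x => hB (M i) _)⟩
  have h := G.ultraApprox_formulaOn U hM φ.form (fun i b => ultraRep U M (φ.par b) i)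
    (half_pos hε)
  rw [ultraTuple_ultraRep] at h
  have h' := h.mono U hM (g := f) hφ
  rwa [add_halves] at h'

variable (H : ∀ i, G.GroupIn (M i))

include H in
-- For almost all `i` the two predicates are uniformly close on `G(M_i)`, and a mean is 1-Lipschitz
-- for the supremum norm.
theorem GroupPredicates.UltraApprox.eventually_abs_sub_le (m : ∀ i, G.Mean (M i)) {ε η : ℝ}
    {f : G.points (ultraproduct U M) → ℝ} {p q : ∀ i, G.predicatesOn (M i)}
    (hp : G.UltraApprox U hM ε f p) (hq : G.UltraApprox U hM η f q) :
    ∀ᶠ i in (U : Filter I), |(m i).toFun (p i) - (m i).toFun (q i)| ≤ ε + η := by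
  have : ∀ i, Nonempty (G.points (M i)) := fun i => ⟨(H i).group.one⟩
  have h : ∀ᶠ i in (U : Filter I), ∀ x, |(p i : G.points (M i) → ℝ) x -
      (q i : G.points (M i) → ℝ) x| ≤ ε + η := by
    refine eventually_forall_of_forall_eventually fun x => ?_
    filter_upwards [hp x, hq x] with i h₁ h₂
    rw [abs_sub_comm] at h₁
    exact (abs_sub_le _ (f (G.ultraPoint U hM x)) _).trans (add_le_add h₁ h₂)
  exact h.mono fun i hi => (m i).abs_sub_le _ _ hi

variable (m : ∀ i, G.Mean (M i))

include H in
-- Approximations with errors `(1/2)^n` have limiting means `s n` that form a Cauchy sequence.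
theorem GroupPredicates.exists_hasUltraMean (f : G.predicatesOn (ultraproduct U M)) :
    ∃ r, G.HasUltraMean U hM m f r := by
  choose p s hp hs using fun n : ℕ =>
    G.exists_ultraApprox U hM m f (show (0 : ℝ) < (1 / 2) ^ n by positivity)
  have h0 : Tendsto (fun n : ℕ => (1 / 2 : ℝ) ^ n) atTop (𝓝 0) :=
    tendsto_pow_atTop_nhds_zero_of_lt_one (by norm_num) (by norm_num)
  have hd : ∀ n k, |s n - s k| ≤ (1 / 2) ^ n + (1 / 2) ^ k := fun n k =>
    le_of_tendsto ((hs n).sub (hs k)).abs ((hp n).eventually_abs_sub_le U hM H m (hp k))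
  have hc : CauchySeq s := by
    refine Metric.cauchySeq_iff.2 fun ε hε => ?_
    obtain ⟨K, hK⟩ := eventually_atTop.1 (h0.eventually_lt_const (half_pos hε))
    refine ⟨K, fun n hn k hk => (hd n k).trans_lt ?_⟩
    linarith [hK n hn, hK k hk]
  obtain ⟨r, hr⟩ := cauchySeq_tendsto_of_complete hc
  refine ⟨r, fun ε hε => ?_⟩
  obtain ⟨n, hn, hn'⟩ := ((h0.eventually_lt_const hε).and
    (Metric.tendsto_nhds.1 hr (ε / 2) (half_pos hε))).exists
  refine ⟨p n, fun x => (hp n x).mono fun i hi => hi.trans hn.le, ?_⟩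
  filter_upwards [Metric.tendsto_nhds.1 (hs n) (ε / 2) (half_pos hε)] with i hi
  have := (dist_triangle _ _ _).trans (add_le_add hi.le hn'.le)
  rwa [add_halves] at this

include H in
theorem GroupPredicates.HasUltraMean.abs_sub_le {f : G.points (ultraproduct U M) → ℝ} {r ε : ℝ}
    (hr : G.HasUltraMean U hM m f r) {p : ∀ i, G.predicatesOn (M i)}
    (hp : G.UltraApprox U hM ε f p) {η : ℝ} (hη : 0 < η) :
    ∀ᶠ i in (U : Filter I), |(m i).toFun (p i) - r| ≤ ε + η := by
  obtain ⟨q, hq, hqr⟩ := hr (η / 2) (half_pos hη)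
  filter_upwards [hp.eventually_abs_sub_le U hM H m hq, hqr] with i h₁ h₂
  have := (_root_.abs_sub_le _ _ _).trans (add_le_add h₁ h₂)
  linarith

include H in
theorem GroupPredicates.HasUltraMean.unique {f : G.points (ultraproduct U M) → ℝ} {r s : ℝ}
    (hr : G.HasUltraMean U hM m f r) (hs : G.HasUltraMean U hM m f s) : r = s := by
  refine eq_of_forall_dist_le fun ε hε => ?_
  obtain ⟨p, hp, hpr⟩ := hr (ε / 4) (by positivity)
  obtain ⟨i, h₁, h₂⟩ :=
    (hpr.and (hs.abs_sub_le U hM H m hp (show 0 < ε / 4 by positivity))).exists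
  rw [Real.dist_eq]
  rw [abs_sub_comm] at h₁
  have := (_root_.abs_sub_le _ _ _).trans (add_le_add h₁ h₂)
  linarith

theorem GroupPredicates.HasUltraMean.add {f g : G.points (ultraproduct U M) → ℝ} {r s : ℝ}
    (hr : G.HasUltraMean U hM m f r) (hs : G.HasUltraMean U hM m g s) :
    G.HasUltraMean U hM m (f + g) (r + s) := by
  intro ε hε
  obtain ⟨p, hp, hpr⟩ := hr (ε / 2) (half_pos hε)
  obtain ⟨q, hq, hqs⟩ := hs (ε / 2) (half_pos hε)
  refine ⟨p + q, fun x => ?_, ?_⟩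
  · filter_upwards [hp x, hq x] with i h₁ h₂
    have := (abs_add_le _ _).trans (add_le_add h₁ h₂)
    rw [add_halves] at this
    refine le_of_eq_of_le (congrArg abs ?_) this
    change f _ + g _ - ((p i : G.points (M i) → ℝ) _ + (q i : G.points (M i) → ℝ) _) = _
    ring
  · filter_upwards [hpr, hqs] with i h₁ h₂
    have := (abs_add_le _ _).trans (add_le_add h₁ h₂)
    rw [add_halves] at this
    rw [Pi.add_apply, map_add]
    refine le_of_eq_of_le (congrArg abs ?_) this
    ring

theorem GroupPredicates.HasUltraMean.smul {f : G.points (ultraproduct U M) → ℝ} {r : ℝ}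
    (hr : G.HasUltraMean U hM m f r) (c : ℝ) : G.HasUltraMean U hM m (c • f) (c * r) := by
  intro ε hε
  -- Adding `1` to `|c|` covers `c = 0`.
  obtain ⟨p, hp, hpr⟩ := hr (ε / (|c| + 1)) (by positivity)
  have hc : ∀ t : ℝ, |t| ≤ ε / (|c| + 1) → |c * t| ≤ ε := fun t ht => by
    rw [le_div_iff₀ (by positivity)] at ht
    rw [abs_mul]
    nlinarith [abs_nonneg t]
  refine ⟨c • p, fun x => ?_, ?_⟩
  · filter_upwards [hp x] with i hi
    refine le_of_eq_of_le (congrArg abs ?_) (hc _ hi)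
    exact (mul_sub _ _ _).symm
  · filter_upwards [hpr] with i hi
    rw [Pi.smul_apply, map_smul, smul_eq_mul, ← mul_sub]
    exact hc _ hi

include H in
theorem GroupPredicates.HasUltraMean.nonneg {f : G.points (ultraproduct U M) → ℝ} {r : ℝ}
    (hr : G.HasUltraMean U hM m f r) (hf : ∀ x, 0 ≤ f x) : 0 ≤ r := by
  have : ∀ i, Nonempty (G.points (M i)) := fun i => ⟨(H i).group.one⟩
  refine le_of_forall_pos_le_add fun ε hε => ?_
  obtain ⟨p, hp, hpr⟩ := hr (ε / 2) (half_pos hε)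
  have h : ∀ᶠ i in (U : Filter I), ∀ x, -(ε / 2) ≤ (p i : G.points (M i) → ℝ) x := by
    refine eventually_forall_of_forall_eventually fun x => ?_
    filter_upwards [hp x] with i hi
    linarith [(abs_le.1 hi).2, hf (G.ultraPoint U hM x)]
  obtain ⟨i, h₁, h₂⟩ := (h.and hpr).exists
  linarith [(m i).le_of_forall_le _ h₁, (abs_le.1 h₂).2]

theorem GroupPredicates.hasUltraMean_one : G.HasUltraMean U hM m 1 1 := by
  refine fun ε hε => ⟨fun i => G.res (M i) ⟨1, (M i).one_mem_predicates G.Γ⟩,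
    fun x => Eventually.of_forall fun i => ?_, Eventually.of_forall fun i => ?_⟩
  · change |(1 : ℝ) - 1| ≤ ε
    simpa using hε.le
  · rw [(m i).map_one]
    simpa using hε.le

/-- The ultralimit of the means `m i`. -/
noncomputable def GroupPredicates.ultraMean : G.Mean (ultraproduct U M) where
  toFun :=
    { toFun := fun f => (G.exists_hasUltraMean U hM H m f).choose
      map_add' := fun f g => (G.exists_hasUltraMean U hM H m (f + g)).choose_spec.unique U hM H m
        ((G.exists_hasUltraMean U hM H m f).choose_spec.add U hM m
          (G.exists_hasUltraMean U hM H m g).choose_spec)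
      map_smul' := fun c f => (G.exists_hasUltraMean U hM H m (c • f)).choose_spec.unique U hM H m
        ((G.exists_hasUltraMean U hM H m f).choose_spec.smul U hM m c) }
  nonneg f hf := (G.exists_hasUltraMean U hM H m f).choose_spec.nonneg U hM H m hf
  map_one := (G.exists_hasUltraMean U hM H m _).choose_spec.unique U hM H m
    (G.hasUltraMean_one U hM m)

theorem GroupPredicates.hasUltraMean_ultraMean (f : G.predicatesOn (ultraproduct U M)) :
    G.HasUltraMean U hM m f ((G.ultraMean U hM H m).toFun f) :=
  (G.exists_hasUltraMean U hM H m f).choose_spec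

theorem GroupPredicates.isUltralimit_ultraMean :
    Mean.IsUltralimit U m (G.ultraMean U hM H m) := by
  intro β Δ φ a
  refine Metric.tendsto_nhds.2 fun ε hε => ?_
  filter_upwards [(G.hasUltraMean_ultraMean U hM H m _).abs_sub_le U hM H m
    (G.ultraApprox_formulaOn U hM φ a (show 0 < ε / 4 by positivity))
    (show 0 < ε / 4 by positivity)] with i hi
  rw [Real.dist_eq]
  linarith

/-- The ultralimit condition speaks of formulas only; their density in the predicates fixes all
other values, whence uniqueness. -/
theorem GroupPredicates.Mean.IsUltralimit.hasUltraMean {m' : G.Mean (ultraproduct U M)}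
    (h : Mean.IsUltralimit U m m') (f : G.predicatesOn (ultraproduct U M)) :
    G.HasUltraMean U hM m f (m'.toFun f) := by
  intro ε hε
  obtain ⟨φ, hφ⟩ := G.exists_formulaOn f (half_pos hε)
  have h₁ := G.ultraApprox_formulaOn U hM φ.form (fun i b => ultraRep U M (φ.par b) i)
    (half_pos hε)
  have h₂ := h _ _ φ.form (fun i b => ultraRep U M (φ.par b) i)
  rw [ultraTuple_ultraRep] at h₁ h₂
  have h₃ := h₁.mono U hM (g := f) hφ
  rw [add_halves] at h₃
  refine ⟨_, h₃, ?_⟩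
  have h₄ := m'.abs_sub_le (G.formulaOn _ φ.form φ.par) f (c := ε / 2) fun x => by
    rw [abs_sub_comm]; exact hφ x
  filter_upwards [Metric.tendsto_nhds.1 h₂ (ε / 2) (half_pos hε)] with i hi
  have := (_root_.abs_sub_le _ _ _).trans (add_le_add hi.le h₄)
  rwa [add_halves] at this

theorem GroupPredicates.Mean.IsUltralimit.eq_ultraMean {m' : G.Mean (ultraproduct U M)}
    (h : Mean.IsUltralimit U m m') : m' = G.ultraMean U hM H m :=
  Mean.ext' fun f => (h.hasUltraMean U hM m f).unique U hM H m
    (G.hasUltraMean_ultraMean U hM H m f)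

theorem GroupPredicates.invariant_ultraMean (hm : ∀ i, (m i).Invariant (H i)) :
    (G.ultraMean U hM H m).Invariant (GroupIn.ultraproduct U hM H) := by
  let _ := fun i => (H i).group
  let _ := (GroupIn.ultraproduct U hM H).group
  intro g P P' hP
  obtain ⟨g, rfl⟩ := G.ultraPoint_surjective U hM H g
  refine (G.hasUltraMean_ultraMean U hM H m P').unique U hM H m fun ε hε => ?_
  obtain ⟨p, hp, hpr⟩ := G.hasUltraMean_ultraMean U hM H m P ε hε
  -- The translates by `g i` of a family approximating `P` approximate the translate of `P`, and
  -- have the same means.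
  refine ⟨fun i => ⟨_, (H i).translate_mem_predicatesOn (hM i) (g i) (p i)⟩, fun x => ?_, ?_⟩
  · rw [hP, G.ultraPoint_inv_mul U hM H]
    exact hp fun i => (g i)⁻¹ * x i
  · filter_upwards [hpr] with i hi
    rwa [hm i (g i) (p i) _ fun x => rfl]

end UltraMean

/-! ### Types -/

section Types

variable {M N : Structure.{u, v} L} {j : ∀ s, M.carrier s → N.carrier s} {n : ℕ}
  {Γ : Fin n → L.Sorts}

theorem ParamFormula.evalIn_lin (c d : ℝ) (φ ψ : ParamFormula M Γ) (y : N.Assign Γ) :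
    (ParamFormula.lin c d φ ψ).evalIn N j y = c * φ.evalIn N j y + d * ψ.evalIn N j y := by
  simp only [ParamFormula.lin, ParamFormula.evalIn, Formula.eval, Matrix.cons_val_zero,
    Matrix.cons_val_one, Formula.eval_subst]
  congr 3 <;>
  · funext a
    rcases a with a | b <;> rfl

theorem ParamFormula.eval_const (c : ℝ) (x : M.Assign Γ) :
    (ParamFormula.const M Γ c).eval x = c := rfl

theorem ParamFormula.evalIn_const (c : ℝ) (y : N.Assign Γ) :
    (ParamFormula.const M Γ c).evalIn N j y = c := rfl

/-- A lower bound over all tuples is a bound on the infimum formula at the parameters, whose value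
is preserved by `j`. -/
theorem IsElementary.le_evalIn (hj : IsElementary M N j) (φ : ParamFormula M Γ) {c : ℝ}
    (h : ∀ x, c ≤ φ.eval x) (y : N.Assign Γ) : c ≤ φ.evalIn N j y := by
  obtain ⟨ψ, hψ⟩ := Formula.exists_infTuple.{u, v} φ.form
  refine le_trans ?_ ((hψ N fun b => j _ (φ.par b)).1 ⟨y, rfl⟩)
  rw [hj]
  refine (hψ M φ.par).2 ?_
  rintro _ ⟨x, rfl⟩
  exact h x

theorem IsElementary.abs_evalIn_sub_le (hj : IsElementary M N j) (φ ψ : ParamFormula M Γ)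
    {c : ℝ} (h : ∀ x, |φ.eval x - ψ.eval x| ≤ c) (y : N.Assign Γ) :
    |φ.evalIn N j y - ψ.evalIn N j y| ≤ c := by
  have h₁ := hj.le_evalIn (.lin 1 (-1) φ ψ) (c := -c) (fun x => by
    rw [ParamFormula.eval_lin]; linarith [(abs_le.1 (h x)).1]) y
  have h₂ := hj.le_evalIn (.lin 1 (-1) ψ φ) (c := -c) (fun x => by
    rw [ParamFormula.eval_lin]; linarith [(abs_le.1 (h x)).2]) y
  rw [ParamFormula.evalIn_lin] at h₁ h₂
  exact abs_le.2 ⟨by linarith, by linarith⟩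

/-- Formulas close to `P` on `M` are close to each other on `M`, hence also on `N` by elementarity.
-/
theorem HasValueIn.unique (hj : IsElementary M N j) {P : M.Assign Γ → ℝ} {y : N.Assign Γ}
    {r s : ℝ} (hr : HasValueIn P N j y r) (hs : HasValueIn P N j y s) : r = s := by
  refine eq_of_forall_dist_le fun ε hε => ?_
  obtain ⟨φ, h₁, h₂⟩ := hr (ε / 4) (by positivity)
  obtain ⟨ψ, h₃, h₄⟩ := hs (ε / 4) (by positivity)
  have h₅ := abs_le.1 (hj.abs_evalIn_sub_le φ ψ (c := ε / 2) (fun x => by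
    have e₁ := abs_le.1 (h₁ x)
    have e₂ := abs_le.1 (h₃ x)
    exact abs_le.2 ⟨by linarith, by linarith⟩) y)
  rw [abs_le] at h₂ h₄
  rw [Real.dist_eq, abs_le]
  constructor <;> linarith

theorem HasValueIn.add_const {P : M.Assign Γ → ℝ} {y : N.Assign Γ} {r : ℝ}
    (hr : HasValueIn P N j y r) (c : ℝ) : HasValueIn (fun x => P x + c) N j y (r + c) := by
  intro ε hε
  obtain ⟨φ, h₁, h₂⟩ := hr ε hε
  refine ⟨.lin 1 c φ (.const M Γ 1), fun x => ?_, ?_⟩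
  · rw [ParamFormula.eval_lin, ParamFormula.eval_const, one_mul, mul_one, add_sub_add_right_eq_sub]
    exact h₁ x
  · rw [ParamFormula.evalIn_lin, ParamFormula.evalIn_const, one_mul, mul_one,
      add_sub_add_right_eq_sub]
    exact h₂

theorem ParamFormula.hasValueIn (φ : ParamFormula M Γ) (y : N.Assign Γ) :
    HasValueIn φ.eval N j y (φ.evalIn N j y) :=
  fun ε hε => ⟨φ, fun x => by simpa using hε.le, by simpa using hε.le⟩

end Types

section TypeMean

variable {G : GroupPredicates.{u, w} T} {M : Structure.{u, v} L}

theorem GroupPredicates.Mean.sub_const_mem_ker (m : G.Mean M) (P : M.predicates G.Γ) :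
    P - m.toFun (G.res M P) • ⟨1, M.one_mem_predicates G.Γ⟩ ∈ m.ker := by
  have h : G.res M (P - m.toFun (G.res M P) • ⟨1, M.one_mem_predicates G.Γ⟩) =
    G.res M P - m.toFun (G.res M P) • G.res M ⟨1, M.one_mem_predicates G.Γ⟩ := rfl
  change m.toFun _ = 0
  rw [h, map_sub, map_smul, m.map_one, smul_eq_mul, mul_one, sub_self]

/-- A tuple realizing the kernel of a mean gives every predicate the value of the mean. -/
theorem GroupPredicates.Mean.hasValueIn (m : G.Mean M) {N : Structure.{u, v} L}
    {j : ∀ s, M.carrier s → N.carrier s} {y : N.Assign G.Γ} {p : Set (M.predicates G.Γ)}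
    (hp : m.ker ⊆ p) (h : ∀ P ∈ p, HasValueIn (P : M.Assign G.Γ → ℝ) N j y 0)
    (P : M.predicates G.Γ) :
    HasValueIn (P : M.Assign G.Γ → ℝ) N j y (m.toFun (G.res M P)) := by
  have h1 := (h _ (hp (m.sub_const_mem_ker P))).add_const (m.toFun (G.res M P))
  rw [zero_add] at h1
  refine (congrArg (fun f => HasValueIn f N j y _) (funext fun x => ?_)).mp h1
  change (P : M.Assign G.Γ → ℝ) x - m.toFun (G.res M P) * 1 + m.toFun (G.res M P) = _
  ring

/-- Maximality is automatic: a tuple realizing a larger set `q` realizes the kernel, so it gives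
each `P ∈ q` the value `m(P)` as well as `0`. -/
theorem GroupPredicates.Mean.isType_of_isPartialType (m : G.Mean M)
    (h : IsPartialType M G.Γ m.ker) : m.IsType := by
  refine ⟨h, fun q hq hle P hP => ?_⟩
  obtain ⟨N, j, y, hj, hy⟩ := hq
  exact (m.hasValueIn hle hy P).unique hj (hy P hP)

end TypeMean

/-- Łoś in both ultraproducts: the two values are limits of families that agree at each index. -/
theorem isElementary_ultraproduct {I : Type w} (U : Ultrafilter I) {M N : I → Structure.{u, v} L}
    (j : ∀ i s, (M i).carrier s → (N i).carrier s) (hj : ∀ i, IsElementary (M i) (N i) (j i)) :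
    IsElementary (ultraproduct U M) (ultraproduct U N)
      fun s x => ultraMk U N fun i => j i s (ultraRep U M x i) := by
  intro α Γ φ x
  refine tendsto_nhds_unique (φ.tendsto_eval U N fun i a => j i _ (ultraRep U M (x a) i)) ?_
  have h := φ.tendsto_eval U M fun i a => ultraRep U M (x a) i
  rw [ultraTuple_ultraRep] at h
  exact h.congr fun i => (hj i _ _ φ _).symm

theorem GroupPredicates.Mean.IsUltralimit.isType {G : GroupPredicates.{u, v} T} {I : Type w}
    {U : Ultrafilter I} {M : I → Structure.{u, v} L} {m : ∀ i, G.Mean (M i)}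
    {m' : G.Mean (ultraproduct U M)} (h : Mean.IsUltralimit U m m') (hm : ∀ i, (m i).IsType) :
    m'.IsType := by
  choose N j y hj hy using fun i => (hm i).1
  refine m'.isType_of_isPartialType ⟨ultraproduct U N, _, ultraTuple U N y,
    isElementary_ultraproduct U j hj, fun P hP ε hε => ?_⟩
  obtain ⟨φ, hφ⟩ := P.2 ε hε
  refine ⟨φ, hφ, ?_⟩
  -- At each index, `y i` realizes the kernel of `m i` and so gives the formula the value of `m i`.
  -- In the limit, Łoś handles the values at `y i`, and the ultralimit hypothesis handles the means.
  have hφ' : φ.evalIn (ultraproduct U N)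
      (fun s x => ultraMk U N fun i => j i s (ultraRep U M x i)) (ultraTuple U N y) =
      m'.toFun (G.formulaOn _ φ.form φ.par) := by
    have h₁ := φ.form.tendsto_eval U N fun i =>
      (N i).pair (y i) fun b => j i _ (ultraRep U M (φ.par b) i)
    have h₂ := h _ _ φ.form fun i b => ultraRep U M (φ.par b) i
    rw [ultraTuple_ultraRep] at h₂
    rw [← pair_ultraTuple] at h₁
    refine tendsto_nhds_unique h₁ (h₂.congr fun i => ?_)
    exact ((m i).hasValueIn le_rfl (hy i) ⟨_, ParamFormula.eval_mem ⟨φ.form, _⟩⟩).unique (hj i)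
      (ParamFormula.hasValueIn _ (y i))
  rw [hφ', ← show m'.toFun (G.res _ P) = 0 from hP]
  exact m'.abs_sub_le _ _ fun x => hφ x

end MetricLanguage

theorem mainTheorem9 {L : MetricLanguage.{u}} {I : Type w} (U : Ultrafilter I)
    (M : I → Structure.{u, v} L) (T : Theory L) (hT : ∀ i, (M i).theory = T)
    (G : GroupPredicates.{u, v} T) (H : ∀ i, G.GroupIn (M i)) :
    ∃ H' : G.GroupIn (ultraproduct U M),
      ((∀ i, (H i).DefinablyAmenable) → H'.DefinablyAmenable) ∧
      ((∀ i, (H i).ExtremelyDefinablyAmenable) → H'.ExtremelyDefinablyAmenable) ∧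
      ∀ m : ∀ i, G.Mean (M i), (∀ i, (m i).Invariant (H i)) →
        ∃ m' : G.Mean (ultraproduct U M),
          GroupPredicates.Mean.IsUltralimit U m m' ∧
          (∀ m'' : G.Mean (ultraproduct U M),
            GroupPredicates.Mean.IsUltralimit U m m'' → m'' = m') ∧
          m'.Invariant H' ∧
          ((∀ i, (m i).IsType) → m'.IsType) := by
  have hM : ∀ i, (M i).Models T := fun i => (hT i).ge
  refine ⟨GroupPredicates.GroupIn.ultraproduct U hM H, fun h => ?_, fun h => ?_, fun m hm =>
    ⟨G.ultraMean U hM H m, G.isUltralimit_ultraMean U hM H m,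
      fun _ h => h.eq_ultraMean U hM H m, G.invariant_ultraMean U hM H m hm,
      (G.isUltralimit_ultraMean U hM H m).isType⟩⟩
  · choose m hm using h
    exact ⟨_, G.invariant_ultraMean U hM H m hm⟩
  · choose m hm ht using h
    exact ⟨_, G.invariant_ultraMean U hM H m hm, (G.isUltralimit_ultraMean U hM H m).isType ht⟩
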